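/- Let $r\ge 1$, let $A_n\in\mathbb C^{r\times r}$ ($n\ge1$) be nonsingular and $B_n\in\mathbb C^{r\times r}$ ($n\ge0$) Hermitian, with $A_n\to A$ and $B_n\to B$ as $n\to\infty$, where $A$ is nonsingular and $B$ is Hermitian. Define matrix polynomials $P_n$ by $P_{-1}\equiv 0$, $P_0\equiv I_r$ and $$xP_n(x)=A_{n+1}P_{n+1}(x)+B_nP_n(x)+A_n^*P_{n-1}(x),\qquad n\ge 0 .$$ (The value of $A_0$ is irrelevant, since $P_{-1}\equiv0$.) Let $M>0$ be such that all zeros of all polynomials $\det P_n$ lie in $[-M,M]$. For $x\in\mathbb C$ put $f(z,x)=\det(zA^*+B+z^{-1}A-xI_r)$ and let $z_1(x),\dots,z_{2r}(x)$ be the $2r$ roots $z$ of $f(z,x)=0$, that is, of the polynomial $z^rf(z,x)$, repeated according to multiplicity and labelled so that $|z_1(x)|\le\dots\le|z_{2r}(x)|$ (ties being broken arbitrarily). Call $\mathbf v_1(x),\dots,\mathbf v_{2r}(x)\in\mathbb C^r$ admissible if each $\mathbf v_k(x)$ has Euclidean norm $1$, satisfies $(z_k(x)A^*+B+z_k(x)^{-1}A-xI_r)\mathbf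 v_k(x)=0$, and for each $k$ the dimension of the span of $\{\mathbf v_l(x): z_l(x)=z_k(x)\}$, the dimension of the null space of $z_k(x)A^*+B+z_k(x)^{-1}A-xI_r$, and the multiplicity of $z_k(x)$ as a root of $z^rf(z,x)$ are all equal. Let $S$ be the set of all $x\in\mathbb C$ for which no admissible vectors exist. Then $S$ is finite. For every $x\in\mathbb C\setminus([-M,M]\cup S)$ the limit $R(x)=\lim_{n\to\infty}P_n(x)P_{n+1}(x)^{-1}$ exists entrywise and is diagonalizable, and for every labelling of the roots as above and every admissible choice of vectors, $\mathbf v_1(x),\dots,\mathbf v_r(x)$ are linearly independent and $$R(x)\mathbf v_k(x)=z_k(x)\mathbf v_k(x),\qquad k=1,\dots,r .$$ The convergence $P_n(x)P_{n+1}(x)^{-1}\to R(x)$ is uniform for $x$ in compact subsets $K$ of $\mathbb C\setminus([-M,M]\cup S)$. Moreover, for every labelling and every admissible choice of vectors at all points $x\in K$, the convergence $P_n(x)P_{n+1}(x)^{-1}\mathbf v_k(x)\to z_k(x)\mathbf v_k(x)$ is uniform for $k\in\{1,\dots,r\}$ and $x\in K$. -/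

import Mathlib

open Filter Topology Polynomial

/-- The matrix polynomials `Pₙ(x)` generated by the recurrence
`x Pₙ(x) = A_{n+1} P_{n+1}(x) + Bₙ Pₙ(x) + Aₙ* P_{n-1}(x)`, `n ≥ 0`, with `P₋₁ = 0` and `P₀ = I`,
solved for `P_{n+1}`. The coefficient `a 0` multiplies `P₋₁ = 0` and is not used. -/
noncomputable def matrixOP {r : ℕ} (a b : ℕ → Matrix (Fin r) (Fin r) ℂ) :
    ℕ → ℂ → Matrix (Fin r) (Fin r) ℂ
  | 0, _ => 1
  | 1, x => (a 1)⁻¹ * (x • (1 : Matrix (Fin r) (Fin r) ℂ) - b 0)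
  | n + 2, x => (a (n + 2))⁻¹ *
      ((x • (1 : Matrix (Fin r) (Fin r) ℂ) - b (n + 1)) * matrixOP a b (n + 1) x
        - (a (n + 1)).conjTranspose * matrixOP a b n x)

/-- The recurrence for `n = 0`. -/
theorem matrixOP_recurrence_zero {r : ℕ} (a b : ℕ → Matrix (Fin r) (Fin r) ℂ)
    (ha : IsUnit (a 1)) (x : ℂ) :
    x • matrixOP a b 0 x = a 1 * matrixOP a b 1 x + b 0 * matrixOP a b 0 x := by
  have h : IsUnit (a 1).det := (Matrix.isUnit_iff_isUnit_det _).1 ha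
  simp only [matrixOP]
  rw [Matrix.mul_nonsing_inv_cancel_left _ _ h, mul_one]
  abel

/-- The recurrence for `n ≥ 1`. -/
theorem matrixOP_recurrence_succ {r : ℕ} (a b : ℕ → Matrix (Fin r) (Fin r) ℂ) (n : ℕ)
    (ha : IsUnit (a (n + 2))) (x : ℂ) :
    x • matrixOP a b (n + 1) x = a (n + 2) * matrixOP a b (n + 2) x
      + b (n + 1) * matrixOP a b (n + 1) x
      + (a (n + 1)).conjTranspose * matrixOP a b n x := by
  have h : IsUnit (a (n + 2)).det := (Matrix.isUnit_iff_isUnit_det _).1 ha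
  rw [show matrixOP a b (n + 2) x = (a (n + 2))⁻¹ *
      ((x • (1 : Matrix (Fin r) (Fin r) ℂ) - b (n + 1)) * matrixOP a b (n + 1) x
        - (a (n + 1)).conjTranspose * matrixOP a b n x) from rfl,
    Matrix.mul_nonsing_inv_cancel_left _ _ h, sub_mul, smul_mul_assoc, one_mul]
  abel

/-- The interval `[-M, M]` of the real line, as a subset of `ℂ`. -/
def realSegment (M : ℝ) : Set ℂ := Complex.ofReal '' Set.Icc (-M) M

/-- The matrix `z A* + B + z⁻¹ A - x I`. -/
noncomputable def symbolMatrix {r : ℕ} (A B : Matrix (Fin r) (Fin r) ℂ) (z x : ℂ) :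
    Matrix (Fin r) (Fin r) ℂ :=
  z • A.conjTranspose + B + z⁻¹ • A - x • (1 : Matrix (Fin r) (Fin r) ℂ)

/-- The polynomial `Z ^ r * f(Z, x)` in `Z`, where `f(z, x) = det (z A* + B + z⁻¹ A - x I)`;
that is, `det (Z² A* + Z (B - x I) + A)`. -/
noncomputable def symbolPoly {r : ℕ} (A B : Matrix (Fin r) (Fin r) ℂ) (x : ℂ) : ℂ[X] :=
  Matrix.det ((X ^ 2 : ℂ[X]) • A.conjTranspose.map C
    + (X : ℂ[X]) • (B - x • (1 : Matrix (Fin r) (Fin r) ℂ)).map C + A.map C)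

theorem symbolPoly_eval {r : ℕ} (A B : Matrix (Fin r) (Fin r) ℂ) (x z : ℂ) (hz : z ≠ 0) :
    (symbolPoly A B x).eval z = z ^ r * (symbolMatrix A B z x).det := by
  have h := Matrix.det_smul (symbolMatrix A B z x) z
  rw [Fintype.card_fin] at h
  rw [← h, symbolPoly, ← Polynomial.coe_evalRingHom, RingHom.map_det]
  congr 1
  ext i j
  simp only [symbolMatrix, RingHom.mapMatrix_apply, Matrix.map_apply, Matrix.add_apply,
    Matrix.smul_apply, Matrix.sub_apply, smul_eq_mul, Polynomial.coe_evalRingHom,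
    Polynomial.eval_add, Polynomial.eval_mul, Polynomial.eval_pow, Polynomial.eval_X,
    Polynomial.eval_C]
  field_simp
  ring

/-- The geometric multiplicity `d(z, x)`: the dimension of the null space of
`z A* + B + z⁻¹ A - x I`. -/
noncomputable def geomMult {r : ℕ} (A B : Matrix (Fin r) (Fin r) ℂ) (z x : ℂ) : ℕ :=
  Module.finrank ℂ (LinearMap.ker (symbolMatrix A B z x).mulVecLin)

/-- The algebraic multiplicity `m₁(z, x)`: the largest `k` such that `(Z - z) ^ k` divides
`Z ^ r * f(Z, x)`. -/
noncomputable def algMult {r : ℕ} (A B : Matrix (Fin r) (Fin r) ℂ) (z x : ℂ) : ℕ :=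
  (symbolPoly A B x).rootMultiplicity z

/-- `z 0, …, z (2r - 1)` is a list of all roots of `f(·, x)`, repeated according to multiplicity
and ordered by increasing modulus (ties being broken arbitrarily). -/
def IsRootLabelling {r : ℕ} (A B : Matrix (Fin r) (Fin r) ℂ) (x : ℂ) (z : Fin (2 * r) → ℂ) :
    Prop :=
  Multiset.map z Finset.univ.val = (symbolPoly A B x).roots ∧ Monotone fun k => ‖z k‖

/-- `v 0, …, v (2r - 1)` are null vectors of Euclidean norm one attached to the roots `z k`, such
that for each `k` the vectors belonging to the root `z k` span a space whose dimension equals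
both the geometric and the algebraic multiplicity of that root. -/
def IsNullVectorChoice {r : ℕ} (A B : Matrix (Fin r) (Fin r) ℂ) (x : ℂ) (z : Fin (2 * r) → ℂ)
    (v : Fin (2 * r) → Fin r → ℂ) : Prop :=
  (∀ k, ‖WithLp.toLp 2 (v k)‖ = 1) ∧
  (∀ k, (symbolMatrix A B (z k) x).mulVec (v k) = 0) ∧
  ∀ k, Module.finrank ℂ (Submodule.span ℂ (v '' {l | z l = z k})) = geomMult A B (z k) x ∧
    geomMult A B (z k) x = algMult A B (z k) x

/-- The set `S` of those `x` for which null vectors as above do not exist. -/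
def exceptionalSet {r : ℕ} (A B : Matrix (Fin r) (Fin r) ℂ) : Set ℂ :=
  {x | ¬ ∃ z v, IsRootLabelling A B x z ∧ IsNullVectorChoice A B x z v}

/-- The matrix `R` is similar to a diagonal matrix. -/
def MatrixDiagonalizable {r : ℕ} (R : Matrix (Fin r) (Fin r) ℂ) : Prop :=
  ∃ (V : Matrix (Fin r) (Fin r) ℂ) (d : Fin r → ℂ), IsUnit V ∧ R = V * Matrix.diagonal d * V⁻¹

/-- The position of an index `k < r` among the `2r` indices. -/
def firstHalf {r : ℕ} (k : Fin r) : Fin (2 * r) := Fin.castLE (by omega) k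

/-! Off `[-M, M]` the ratios are controlled by the spectral theory of the truncated block Jacobi
matrix, which is Hermitian and whose eigenvalues are zeros of `det P_{N+1}`. If `x` has distance at
least `d` from `[-M, M]`, the resolvent bound says that `d² ∑_{k ≤ N} ‖P_k w‖²` is at most `‖A_{N+1}
P_{N+1} w‖²`. A discrete Gronwall argument turns this into geometric decay of `P_k P_{k+m}⁻¹` in
`m`, uniformly in `k` (`norm_matrixOP_mul_inv_sq_le`).

The matrices `W_n = P_n P_{n+1}⁻¹ A_{n+1}⁻¹` satisfy the continued fraction `W_{n+1} = (x - B_{n+1}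
- A_{n+1}* W_n A_{n+1})⁻¹`. Iterating the difference of two such equations sandwiches `W_n - W_m`
between transfer matrices that decay geometrically, so `W_n` is uniformly Cauchy
(`norm_weylRatio_sub_le`). Its limit `W` gives `R = W A`. Since `R^k` is the limit of `P_n
P_{n+k}⁻¹`, all eigenvalues of `R` lie in the open unit disc.

The stationary equation for `W` factors `z` times the symbol as `(z A* - W⁻¹)(z - R)`. By the
symmetry between `x` and its conjugate, the first factor is nonsingular for `|z| ≤ 1`. Hence the `r`
smallest roots are the eigenvalues of `R`, and null vectors of the symbol at these roots are
eigenvectors of `R`.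

For finiteness of `S`, let `s(z, x)` be the squarefree part in `z` of the bivariate determinant. On
`|z| = 1` the matrix `H(z) = zA* + B + z⁻¹A` is Hermitian, hence diagonalizable, and so `s(z, H(z))
= 0`. This identity extends to all `z` and makes the symbol a divisor of the scalar `z^D s(z, x)`
(`exists_symbol_mul_eq`). Where `s(·, x)` has only simple roots, a divisor of such a scalar has
equal geometric and algebraic multiplicities (`finrank_ker_eq_rootMultiplicity_det`). Multiple roots
require a nonzero polynomial in `x` to vanish. -/

/-! ### Truncated block Jacobi operators and their resolvent bound. -/

/-- For a symmetric operator all of whose eigenvalues have distance at least `d` from `x`,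
the operator `x - T` is bounded below by `d`. -/
theorem LinearMap.IsSymmetric.mul_norm_le_norm_smul_sub {E : Type*} [NormedAddCommGroup E]
    [InnerProductSpace ℂ E] [FiniteDimensional ℂ E] {T : E →ₗ[ℂ] E} (hT : T.IsSymmetric)
    {x : ℂ} {d : ℝ} (hd : 0 ≤ d)
    (h : ∀ (μ : ℝ) (v : E), v ≠ 0 → T v = (μ : ℂ) • v → d ≤ ‖x - μ‖) (u : E) :
    d * ‖u‖ ≤ ‖x • u - T u‖ := by
  set e := hT.eigenvectorBasis rfl
  have key : ∀ i, e.repr (x • u - T u) i = (x - (hT.eigenvalues rfl i : ℂ)) * e.repr u i := by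
    intro i
    have := hT.eigenvectorBasis_apply_self_apply rfl u i
    rw [map_sub, map_smul, PiLp.sub_apply, PiLp.smul_apply, this, smul_eq_mul, sub_mul]
    rfl
  have hle : (d * ‖u‖) ^ 2 ≤ ‖x • u - T u‖ ^ 2 := by
    rw [← e.repr.norm_map u, ← e.repr.norm_map (x • u - T u), mul_pow,
      EuclideanSpace.norm_sq_eq, EuclideanSpace.norm_sq_eq, Finset.mul_sum]
    refine Finset.sum_le_sum fun i _ => ?_
    rw [key, norm_mul, mul_pow]
    gcongr
    exact h _ (e i) (e.orthonormal.ne_zero i) (hT.apply_eigenvectorBasis rfl i)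
  exact le_of_sq_le_sq hle (norm_nonneg _)

section ZeroExtend

variable {V : Type*} [AddCommGroup V]

/-- A finite family continued by zero to a sequence. -/
def zeroExtend {N : ℕ} (u : Fin N → V) (k : ℕ) : V := if h : k < N then u ⟨k, h⟩ else 0

theorem zeroExtend_coe {N : ℕ} (u : Fin N → V) (i : Fin N) : zeroExtend u i = u i := by
  simp only [zeroExtend, i.2, dif_pos]

theorem zeroExtend_add {N : ℕ} (u v : Fin N → V) :
    zeroExtend (u + v) = zeroExtend u + zeroExtend v := by
  ext k
  by_cases h : k < N <;> simp [zeroExtend, h]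

theorem zeroExtend_smul [Module ℂ V] {N : ℕ} (c : ℂ) (u : Fin N → V) :
    zeroExtend (c • u) = c • zeroExtend u := by
  ext k
  by_cases h : k < N <;> simp [zeroExtend, h]

end ZeroExtend

section BlockJacobi

variable {V : Type*} [NormedAddCommGroup V] [InnerProductSpace ℂ V] [FiniteDimensional ℂ V]

open ContinuousLinearMap in
/-- The action of the block Jacobi operator with blocks `b i` on the diagonal, `a (i + 1)` above
and `(a (i + 1))†` below it. -/
noncomputable def blockJacobi (a b : ℕ → V →L[ℂ] V) (u : ℕ → V) (i : ℕ) : V :=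
  a (i + 1) (u (i + 1)) + b i (u i) + if i = 0 then 0 else adjoint (a i) (u (i - 1))

/-- Summation by parts: self-adjoint diagonal blocks cancel and the off-diagonal terms telescope to
the boundary. For sequences vanishing at `N + 1` the boundary term is zero, which gives symmetry of
the truncation. -/
theorem blockJacobi_green (a b : ℕ → V →L[ℂ] V) (hb : ∀ i, IsSelfAdjoint (b i)) (u v : ℕ → V)
    (N : ℕ) :
    ∑ i ∈ Finset.range (N + 1), inner ℂ (blockJacobi a b u i) (v i)
      - ∑ i ∈ Finset.range (N + 1), inner ℂ (u i) (blockJacobi a b v i)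
      = inner ℂ (a (N + 1) (u (N + 1))) (v N) - inner ℂ (u N) (a (N + 1) (v (N + 1))) := by
  have hb' : ∀ i (y z : V), inner ℂ (b i y) z = inner ℂ y (b i z) := fun i y z => by
    rw [← ContinuousLinearMap.adjoint_inner_right, (hb i).adjoint_eq]
  induction N with
  | zero =>
    simp only [blockJacobi, zero_add, Finset.sum_range_one, if_true, inner_zero_left,
      inner_zero_right, inner_add_left, inner_add_right, hb']
    ring
  | succ N ih =>
    rw [Finset.sum_range_succ, Finset.sum_range_succ (fun i => inner ℂ (u i) (blockJacobi a b v i)),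
      add_sub_add_comm, ih]
    simp only [blockJacobi, inner_add_left, inner_add_right, hb', Nat.add_eq_zero_iff, one_ne_zero,
      and_false, if_false, ContinuousLinearMap.adjoint_inner_left, add_tsub_cancel_right,
      ContinuousLinearMap.adjoint_inner_right]
    ring

theorem blockJacobi_add (a b : ℕ → V →L[ℂ] V) (u v : ℕ → V) (i : ℕ) :
    blockJacobi a b (u + v) i = blockJacobi a b u i + blockJacobi a b v i := by
  by_cases h : i = 0 <;> simp [blockJacobi, h] <;> abel

theorem blockJacobi_smul (a b : ℕ → V →L[ℂ] V) (c : ℂ) (u : ℕ → V) (i : ℕ) :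
    blockJacobi a b (c • u) i = c • blockJacobi a b u i := by
  by_cases h : i = 0 <;> simp [blockJacobi, h]

/-- The truncation of the block Jacobi operator to the first `N` blocks. -/
noncomputable def blockJacobiTrunc (a b : ℕ → V →L[ℂ] V) (N : ℕ) :
    PiLp 2 (fun _ : Fin N => V) →ₗ[ℂ] PiLp 2 (fun _ : Fin N => V) where
  toFun u := WithLp.toLp 2 fun i => blockJacobi a b (zeroExtend u.ofLp) i
  map_add' u v := by
    ext i
    simp [zeroExtend_add, blockJacobi_add]
  map_smul' c u := by
    ext i
    simp [zeroExtend_smul, blockJacobi_smul]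

theorem blockJacobiTrunc_isSymmetric (a b : ℕ → V →L[ℂ] V) (hb : ∀ i, IsSelfAdjoint (b i))
    (N : ℕ) : (blockJacobiTrunc a b (N + 1)).IsSymmetric := by
  intro u v
  have h := blockJacobi_green a b hb (zeroExtend u.ofLp) (zeroExtend v.ofLp) N
  have h0 : ∀ w : Fin (N + 1) → V, zeroExtend w (N + 1) = 0 := fun w => by simp [zeroExtend]
  rw [h0, h0, map_zero, inner_zero_left, inner_zero_right, sub_zero, sub_eq_zero,
    Finset.sum_range, Finset.sum_range] at h
  have h1 : ∀ (w : Fin (N + 1) → V) (i : Fin (N + 1)), zeroExtend w i = w i := fun w i =>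
    zeroExtend_coe w i
  simp only [h1] at h
  simpa [PiLp.inner_apply, blockJacobiTrunc] using h

/-- If the truncated block Jacobi operator has no eigenvalue closer than `d` to `x`, then a solution
of the recurrence at `x` is controlled by its last term. -/
theorem blockJacobi_solution_bound (a b : ℕ → V →L[ℂ] V) (hb : ∀ i, IsSelfAdjoint (b i))
    {x : ℂ} {d : ℝ} (hd : 0 ≤ d) (N : ℕ)
    (hspec : ∀ (μ : ℝ) (y : ℕ → V), (∃ i ≤ N, y i ≠ 0) → y (N + 1) = 0 →
      (∀ i ≤ N, blockJacobi a b y i = (μ : ℂ) • y i) → d ≤ ‖x - μ‖)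
    (u : ℕ → V) (hu : ∀ i ≤ N, blockJacobi a b u i = x • u i) :
    d ^ 2 * ∑ i ∈ Finset.range (N + 1), ‖u i‖ ^ 2 ≤ ‖a (N + 1) (u (N + 1))‖ ^ 2 := by
  set w : PiLp 2 (fun _ : Fin (N + 1) => V) := WithLp.toLp 2 fun i => u i with hw
  have h := (blockJacobiTrunc_isSymmetric a b hb N).mul_norm_le_norm_smul_sub (x := x) hd
    (fun μ v hv hμ => hspec μ (zeroExtend v.ofLp) ?_ (by simp [zeroExtend]) ?_) w
  -- Truncation drops only the term `a (N + 1) (u (N + 1))` of the last row, so the residual lives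
  -- in the last block.
  · have hres : x • w - blockJacobiTrunc a b (N + 1) w
        = WithLp.toLp 2 (Pi.single (Fin.last N) (a (N + 1) (u (N + 1)))) := by
      ext i
      have hi := hu i (Nat.lt_succ_iff.1 i.2)
      have hpre : (i : ℕ) - 1 < N + 1 := lt_of_le_of_lt (Nat.sub_le i 1) i.2
      by_cases hl : i = Fin.last N
      · subst hl
        simp only [hw, blockJacobiTrunc, LinearMap.coe_mk, AddHom.coe_mk, PiLp.sub_apply,
          PiLp.smul_apply, Pi.single_eq_same, ← hi, blockJacobi, zeroExtend]
        simp
      · have hlt : (i : ℕ) + 1 < N + 1 := by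
          have := Fin.val_lt_last hl
          omega
        simp only [hw, blockJacobiTrunc, LinearMap.coe_mk, AddHom.coe_mk, PiLp.sub_apply,
          PiLp.smul_apply, Pi.single_eq_of_ne hl, ← hi, blockJacobi, zeroExtend]
        simp [hlt, hpre, Nat.lt_succ_iff.1 i.2]
    have hn : ‖x • w - blockJacobiTrunc a b (N + 1) w‖ = ‖a (N + 1) (u (N + 1))‖ := by
      rw [hres]
      exact PiLp.norm_single 2 (fun _ : Fin (N + 1) => V) _ _
    rw [hn] at h
    have h2 := pow_le_pow_left₀ (by positivity) h 2
    rwa [mul_pow, PiLp.norm_sq_eq_of_L2, ← Finset.sum_range (fun i => ‖u i‖ ^ 2)] at h2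
  · by_contra! hcon
    refine hv ?_
    ext i
    have := hcon i (Nat.lt_succ_iff.1 i.2)
    rwa [zeroExtend_coe] at this
  · intro i hi
    have := congrArg (fun z : PiLp 2 (fun _ : Fin (N + 1) => V) => z ⟨i, Nat.lt_succ_iff.2 hi⟩) hμ
    simpa [blockJacobiTrunc, zeroExtend, Nat.lt_succ_iff.2 hi] using this

end BlockJacobi

/-! ### Geometric decay of `P_k P_n⁻¹` off the zeros. -/

section Bounds

open scoped Matrix.Norms.L2Operator

variable {r : ℕ} {a b : ℕ → Matrix (Fin r) (Fin r) ℂ}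

local notation "Λ" => Matrix.toEuclideanCLM (n := Fin r) (𝕜 := ℂ)

theorem norm_toEuclideanCLM_apply_le (Q : Matrix (Fin r) (Fin r) ℂ) (w : EuclideanSpace ℂ (Fin r)) :
    ‖Λ Q w‖ ≤ ‖Q‖ * ‖w‖ :=
  (Λ Q).le_opNorm w

theorem toEuclideanCLM_mul_apply (P Q : Matrix (Fin r) (Fin r) ℂ)
    (w : EuclideanSpace ℂ (Fin r)) : Λ (P * Q) w = Λ P (Λ Q w) := by
  rw [map_mul]
  rfl

theorem adjoint_toEuclideanCLM (Q : Matrix (Fin r) (Fin r) ℂ) :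
    ContinuousLinearMap.adjoint (Λ Q) = Λ Q.conjTranspose :=
  (map_star (Λ) Q).symm

theorem blockJacobi_matrixOP (ha : ∀ n, 1 ≤ n → IsUnit (a n)) (x : ℂ)
    (w : EuclideanSpace ℂ (Fin r)) (i : ℕ) :
    blockJacobi (fun n => Λ (a n)) (fun n => Λ (b n)) (fun k => Λ (matrixOP a b k x) w) i
      = x • Λ (matrixOP a b i x) w := by
  cases i with
  | zero =>
    have h := congrArg (fun Q => Λ Q w) (matrixOP_recurrence_zero a b (ha 1 le_rfl) x)
    simp only [map_smul, map_add, add_apply,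
      smul_apply, toEuclideanCLM_mul_apply] at h
    simp [blockJacobi, h]
  | succ i =>
    have h := congrArg (fun Q => Λ Q w) (matrixOP_recurrence_succ a b i (ha _ (by omega)) x)
    simp only [map_smul, map_add, add_apply,
      smul_apply, toEuclideanCLM_mul_apply] at h
    simp only [blockJacobi, h, adjoint_toEuclideanCLM]
    simp

/-- Every solution of the recurrence is a solution generated by `matrixOP`. -/
theorem eq_matrixOP_of_blockJacobi (ha : ∀ n, 1 ≤ n → IsUnit (a n)) (x : ℂ)
    (y : ℕ → EuclideanSpace ℂ (Fin r)) (N : ℕ)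
    (hy : ∀ i ≤ N, blockJacobi (fun n => Λ (a n)) (fun n => Λ (b n)) y i = x • y i) :
    ∀ i ≤ N + 1, y i = Λ (matrixOP a b i x) (y 0) := by
  have hinj : ∀ n, 1 ≤ n → Function.Injective (Λ (a n)) := fun n hn u v huv => by
    have h1 : (a n)⁻¹ * a n = 1 :=
      Matrix.nonsing_inv_mul _ ((Matrix.isUnit_iff_isUnit_det _).1 (ha n hn))
    have h2 := congrArg (Λ (a n)⁻¹) huv
    rwa [← toEuclideanCLM_mul_apply, ← toEuclideanCLM_mul_apply,
      h1, map_one] at h2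
  intro i
  induction i using Nat.strong_induction_on with
  | _ i ih =>
    intro hi
    match i, ih, hi with
    | 0, _, _ => simp [matrixOP]
    | i + 1, ih, hi =>
      have h1 := hy i (by omega)
      have h2 := blockJacobi_matrixOP (b := b) ha x (y 0) i
      have h3 : ∀ j ≤ i, y j = Λ (matrixOP a b j x) (y 0) := fun j hj =>
        ih j (by omega) (by omega)
      rw [h3 i le_rfl, ← h2] at h1
      simp only [blockJacobi, h3 i le_rfl, h3 (i - 1) (by omega), add_left_inj] at h1
      exact hinj _ (by omega) h1

/-- An eigenvector `y` of the truncation, with eigenvalue `μ`, is a solution of the recurrence with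
`y (N + 1) = 0`. Hence `P_{N+1}(μ)` kills `y 0`, which is nonzero because it generates `y`. So `μ`
is a zero of `det P_{N+1}` and lies in `[-M, M]`. -/
theorem matrixOP_solution_bound (ha : ∀ n, 1 ≤ n → IsUnit (a n)) (hb : ∀ n, (b n).IsHermitian)
    {M : ℝ} (hzeros : ∀ (n : ℕ) (x : ℂ), (matrixOP a b n x).det = 0 → x ∈ realSegment M)
    {x : ℂ} {d : ℝ} (hd0 : 0 ≤ d) (hd : ∀ t ∈ realSegment M, d ≤ ‖x - t‖) (N : ℕ)
    (w : EuclideanSpace ℂ (Fin r)) :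
    d ^ 2 * ∑ k ∈ Finset.range (N + 1), ‖Λ (matrixOP a b k x) w‖ ^ 2
      ≤ ‖Λ (a (N + 1)) (Λ (matrixOP a b (N + 1) x) w)‖ ^ 2 := by
  refine blockJacobi_solution_bound (fun n => Λ (a n)) (fun n => Λ (b n)) (fun n => ?_) hd0 N ?_
    (fun k => Λ (matrixOP a b k x) w) fun i _ => blockJacobi_matrixOP ha x w i
  · exact (show IsSelfAdjoint (b n) from hb n).map (Λ)
  · rintro μ y ⟨i, hi, hyi⟩ hyN hy
    have h := eq_matrixOP_of_blockJacobi ha μ y N hy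
    refine hd _ (hzeros (N + 1) _ ?_)
    by_contra hdet
    have hu : IsUnit (matrixOP a b (N + 1) μ).det := isUnit_iff_ne_zero.2 hdet
    have h0 := h (N + 1) le_rfl
    rw [hyN] at h0
    have h1 := congrArg (Λ (matrixOP a b (N + 1) μ)⁻¹) h0
    rw [map_zero, ← toEuclideanCLM_mul_apply,
      Matrix.nonsing_inv_mul _ hu, map_one] at h1
    refine hyi ?_
    rw [h i (by omega), ← show (0 : EuclideanSpace ℂ (Fin r)) = y 0 from h1, map_zero]

/-- Growth of partial sums that are dominated by the next increment. -/
theorem le_geometric_of_sum_le {t : ℕ → ℝ} {γ : ℝ} (hγ : 0 ≤ γ) (n : ℕ)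
    (h : ∀ k ≤ n, ∑ j ∈ Finset.range k, t j ≤ γ * t k) :
    ∀ m k, k + m = n → ∑ j ∈ Finset.range (k + 1), t j
      ≤ (γ / (1 + γ)) ^ m * ((1 + γ) * t n) := by
  intro m
  induction m with
  | zero =>
    rintro k rfl
    have := h k le_rfl
    simp only [Finset.sum_range_succ, pow_zero, add_zero] at *
    linarith
  | succ m ih =>
    intro k hk
    have h1 := ih (k + 1) (by omega)
    have h2 := h (k + 1) (by omega)
    rw [Finset.sum_range_succ] at h1
    -- With `σ` the sum on the left, adding `γ * σ` to `σ ≤ γ * t (k + 1)` yields the contraction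
    -- factor `γ / (1 + γ)`.
    have h3 : ∑ j ∈ Finset.range (k + 1), t j
        ≤ γ / (1 + γ) * (∑ j ∈ Finset.range (k + 1), t j + t (k + 1)) := by
      rw [div_mul_eq_mul_div, le_div_iff₀ (by positivity)]
      linarith
    refine h3.trans ?_
    rw [pow_succ', mul_assoc]
    gcongr

/-- Geometric decay of `P_k(x) P_n(x)⁻¹` away from the zeros. -/
theorem norm_matrixOP_mul_inv_sq_le (ha : ∀ n, 1 ≤ n → IsUnit (a n))
    (hb : ∀ n, (b n).IsHermitian)
    {M : ℝ} (hzeros : ∀ (n : ℕ) (x : ℂ), (matrixOP a b n x).det = 0 → x ∈ realSegment M)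
    {c : ℝ} (hc : ∀ n, ‖a n‖ ≤ c)
    {x : ℂ} {d : ℝ} (hd0 : 0 < d) (hd : ∀ t ∈ realSegment M, d ≤ ‖x - t‖) (k m : ℕ) :
    ‖matrixOP a b k x * (matrixOP a b (k + m) x)⁻¹‖ ^ 2
      ≤ (1 + c ^ 2 / d ^ 2) * ((c ^ 2 / d ^ 2) / (1 + c ^ 2 / d ^ 2)) ^ m := by
  set γ := c ^ 2 / d ^ 2 with hγ
  have hγ0 : 0 ≤ γ := by positivity
  have hC : 0 ≤ (1 + γ) * (γ / (1 + γ)) ^ m := by positivity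
  rw [← Real.le_sqrt (norm_nonneg _) hC]
  refine (Λ _).opNorm_le_bound (Real.sqrt_nonneg _) fun w => ?_
  have hx : x ∉ realSegment M := fun h => by
    have := hd x h
    rw [sub_self, norm_zero] at this
    exact absurd this (not_le.2 hd0)
  have hu : IsUnit (matrixOP a b (k + m) x).det :=
    isUnit_iff_ne_zero.2 fun h => hx (hzeros _ _ h)
  set v := Λ (matrixOP a b (k + m) x)⁻¹ w with hv
  have hvw : Λ (matrixOP a b (k + m) x) v = w := by
    rw [hv, ← toEuclideanCLM_mul_apply, Matrix.mul_nonsing_inv _ hu, map_one]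
    rfl
  have hle := le_geometric_of_sum_le (t := fun j => ‖Λ (matrixOP a b j x) v‖ ^ 2) hγ0 (k + m)
    (fun j _ => ?_) m k rfl
  · have h1 : ‖Λ (matrixOP a b k x) v‖ ^ 2 ≤ (1 + γ) * (γ / (1 + γ)) ^ m * ‖w‖ ^ 2 := by
      refine le_trans ?_ (hle.trans_eq ?_)
      · exact Finset.single_le_sum (f := fun j => ‖Λ (matrixOP a b j x) v‖ ^ 2)
          (fun _ _ => sq_nonneg _) (Finset.self_mem_range_succ k)
      · simp only [hvw]
        ring
    rw [toEuclideanCLM_mul_apply, ← Real.sqrt_sq (norm_nonneg w),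
      ← Real.sqrt_mul hC]
    exact Real.le_sqrt_of_sq_le h1
  · cases j with
    | zero => simpa using mul_nonneg hγ0 (sq_nonneg _)
    | succ j =>
      have h1 := matrixOP_solution_bound ha hb hzeros hd0.le hd j v
      have h2 : ‖Λ (a (j + 1)) (Λ (matrixOP a b (j + 1) x) v)‖
          ≤ c * ‖Λ (matrixOP a b (j + 1) x) v‖ :=
        (norm_toEuclideanCLM_apply_le _ _).trans
          (mul_le_mul_of_nonneg_right (hc _) (norm_nonneg _))
      have h3 := h1.trans (pow_le_pow_left₀ (norm_nonneg _) h2 2)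
      rw [hγ, div_mul_eq_mul_div, le_div_iff₀ (by positivity)]
      linarith [mul_pow c ‖Λ (matrixOP a b (j + 1) x) v‖ 2]

end Bounds

/-! ### The continued fraction for the ratios and its transfer matrices. -/

section Weyl

open scoped Matrix.Norms.L2Operator

variable {r : ℕ} {a b : ℕ → Matrix (Fin r) (Fin r) ℂ}

/-- The ratio `P_n(x) P_{n+1}(x)⁻¹ A_{n+1}⁻¹`, which is a block of the resolvent of the truncated
block Jacobi matrix. -/
noncomputable def weylRatio (a b : ℕ → Matrix (Fin r) (Fin r) ℂ) (n : ℕ) (x : ℂ) :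
    Matrix (Fin r) (Fin r) ℂ :=
  matrixOP a b n x * (matrixOP a b (n + 1) x)⁻¹ * (a (n + 1))⁻¹

theorem matrixOP_ratio_eq (ha : ∀ n, 1 ≤ n → IsUnit (a n)) (n : ℕ) (x : ℂ) :
    matrixOP a b n x * (matrixOP a b (n + 1) x)⁻¹ = weylRatio a b n x * a (n + 1) := by
  rw [weylRatio, Matrix.nonsing_inv_mul_cancel_right _ _
    ((Matrix.isUnit_iff_isUnit_det _).1 (ha _ (by omega)))]

theorem weylRatio_zero (ha : ∀ n, 1 ≤ n → IsUnit (a n)) (x : ℂ) :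
    weylRatio a b 0 x = (x • (1 : Matrix (Fin r) (Fin r) ℂ) - b 0)⁻¹ := by
  have h : IsUnit (a 1).det := (Matrix.isUnit_iff_isUnit_det _).1 (ha 1 le_rfl)
  simp only [weylRatio, matrixOP, zero_add, one_mul]
  rw [Matrix.mul_inv_rev, Matrix.nonsing_inv_nonsing_inv _ h, Matrix.mul_assoc,
    Matrix.mul_nonsing_inv _ h, mul_one]

theorem weylRatio_succ (ha : ∀ n, 1 ≤ n → IsUnit (a n)) (n : ℕ) (x : ℂ)
    (hn : IsUnit (matrixOP a b (n + 1) x).det) :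
    weylRatio a b (n + 1) x = (x • (1 : Matrix (Fin r) (Fin r) ℂ) - b (n + 1)
      - (a (n + 1)).conjTranspose * weylRatio a b n x * a (n + 1))⁻¹ := by
  have h := (Matrix.isUnit_iff_isUnit_det _).1 (ha (n + 2) (by omega))
  have h1 : matrixOP a b (n + 2) x = (a (n + 2))⁻¹ *
      ((x • (1 : Matrix (Fin r) (Fin r) ℂ) - b (n + 1)
      - (a (n + 1)).conjTranspose * weylRatio a b n x * a (n + 1)) * matrixOP a b (n + 1) x) := by
    rw [sub_mul _ _ (matrixOP a b (n + 1) x), Matrix.mul_assoc (a (n + 1)).conjTranspose,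
      ← matrixOP_ratio_eq ha, Matrix.mul_assoc _ _ (matrixOP a b (n + 1) x),
      Matrix.nonsing_inv_mul_cancel_right _ _ hn]
    rfl
  rw [weylRatio, h1, Matrix.mul_inv_rev, Matrix.mul_inv_rev, Matrix.nonsing_inv_nonsing_inv _ h,
    Matrix.mul_assoc, Matrix.mul_assoc, Matrix.mul_nonsing_inv _ h, mul_one,
    Matrix.mul_nonsing_inv_cancel_left _ _ hn]

/-- The continued fraction is invariant under taking adjoints and conjugating `x`, because the `b n`
are Hermitian. -/
theorem conjTranspose_weylRatio (ha : ∀ n, 1 ≤ n → IsUnit (a n)) (hb : ∀ n, (b n).IsHermitian)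
    (x : ℂ) (h1 : ∀ n, IsUnit (matrixOP a b n x).det)
    (h2 : ∀ n, IsUnit (matrixOP a b n (star x)).det) (n : ℕ) :
    (weylRatio a b n x).conjTranspose = weylRatio a b n (star x) := by
  induction n with
  | zero =>
    rw [weylRatio_zero ha, weylRatio_zero ha, Matrix.conjTranspose_nonsing_inv]
    simp [(hb 0).eq]
  | succ n ih =>
    rw [weylRatio_succ ha n x (h1 _), weylRatio_succ ha n (star x) (h2 _),
      Matrix.conjTranspose_nonsing_inv]
    simp [(hb (n + 1)).eq, ih, Matrix.mul_assoc]

theorem isUnit_det_weylRatio (ha : ∀ n, 1 ≤ n → IsUnit (a n)) (x : ℂ)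
    (h1 : ∀ n, IsUnit (matrixOP a b n x).det) (n : ℕ) : IsUnit (weylRatio a b n x).det := by
  have h := (Matrix.isUnit_iff_isUnit_det _).1 (ha (n + 1) (by omega))
  rw [weylRatio, Matrix.det_mul, Matrix.det_mul]
  exact ((h1 n).mul (by simpa [Matrix.isUnit_nonsing_inv_det_iff] using h1 (n + 1))).mul
    (by simpa [Matrix.isUnit_nonsing_inv_det_iff] using h)

/-- The continued fraction recurrence, as a left inverse. -/
theorem weylRatio_succ_mul (ha : ∀ n, 1 ≤ n → IsUnit (a n)) (x : ℂ)
    (h1 : ∀ n, IsUnit (matrixOP a b n x).det) (n : ℕ) :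
    weylRatio a b (n + 1) x * (x • (1 : Matrix (Fin r) (Fin r) ℂ) - b (n + 1)
      - (a (n + 1)).conjTranspose * weylRatio a b n x * a (n + 1)) = 1 := by
  have h := isUnit_det_weylRatio ha x h1 (n + 1)
  rw [weylRatio_succ ha n x (h1 _)] at h ⊢
  exact Matrix.nonsing_inv_mul _ (by simpa [Matrix.isUnit_nonsing_inv_det_iff] using h)

/-- The inhomogeneous term in the recurrence for differences of the ratios. -/
noncomputable def weylError (a b : ℕ → Matrix (Fin r) (Fin r) ℂ) (n m : ℕ) (x : ℂ) :
    Matrix (Fin r) (Fin r) ℂ :=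
  b (n + 1) - b (m + 1)
    + (a (n + 1)).conjTranspose * weylRatio a b n x * (a (n + 1) - a (m + 1))
    + (a (n + 1) - a (m + 1)).conjTranspose * weylRatio a b m x * a (m + 1)

/-- The resolvent identity `N1⁻¹ - N2⁻¹ = N1⁻¹ (N2 - N1) N2⁻¹`. Its iteration accumulates right
factors `a W` and left factors `W a*`, the latter being adjoints of `a W` at the conjugate point. -/
theorem weylRatio_sub_succ (ha : ∀ n, 1 ≤ n → IsUnit (a n)) (x : ℂ)
    (h1 : ∀ n, IsUnit (matrixOP a b n x).det) (n m : ℕ) :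
    weylRatio a b (n + 1) x - weylRatio a b (m + 1) x
      = weylRatio a b (n + 1) x * ((a (n + 1)).conjTranspose
        * (weylRatio a b n x - weylRatio a b m x) * a (m + 1) + weylError a b n m x)
        * weylRatio a b (m + 1) x := by
  have hn := weylRatio_succ_mul ha x h1 n
  have hm := mul_eq_one_comm.1 (weylRatio_succ_mul ha x h1 m)
  set N1 := x • (1 : Matrix (Fin r) (Fin r) ℂ) - b (n + 1)
      - (a (n + 1)).conjTranspose * weylRatio a b n x * a (n + 1) with hN1
  set N2 := x • (1 : Matrix (Fin r) (Fin r) ℂ) - b (m + 1)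
      - (a (m + 1)).conjTranspose * weylRatio a b m x * a (m + 1) with hN2
  have h2 : (a (n + 1)).conjTranspose
        * (weylRatio a b n x - weylRatio a b m x) * a (m + 1) + weylError a b n m x = N2 - N1 := by
    rw [hN1, hN2, weylError, Matrix.conjTranspose_sub]
    noncomm_ring
  rw [h2, mul_sub, sub_mul, Matrix.mul_assoc, hm, mul_one, hn, one_mul]

/-- The transfer matrix `A_m P_m(x) P_{m+j}(x)⁻¹ A_{m+j}⁻¹`. -/
noncomputable def transferMatrix (a b : ℕ → Matrix (Fin r) (Fin r) ℂ) (m j : ℕ) (x : ℂ) :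
    Matrix (Fin r) (Fin r) ℂ :=
  a m * (matrixOP a b m x * (matrixOP a b (m + j) x)⁻¹) * (a (m + j))⁻¹

theorem transferMatrix_zero (ha : ∀ n, 1 ≤ n → IsUnit (a n)) (x : ℂ)
    (h1 : ∀ n, IsUnit (matrixOP a b n x).det) (m : ℕ) (hm : 1 ≤ m) :
    transferMatrix a b m 0 x = 1 := by
  rw [transferMatrix, add_zero, Matrix.mul_nonsing_inv _ (h1 m), mul_one,
    Matrix.mul_nonsing_inv _ ((Matrix.isUnit_iff_isUnit_det _).1 (ha m hm))]

theorem transferMatrix_succ (ha : ∀ n, 1 ≤ n → IsUnit (a n)) (x : ℂ)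
    (h1 : ∀ n, IsUnit (matrixOP a b n x).det) (m j : ℕ) :
    transferMatrix a b m (j + 1) x
      = a m * weylRatio a b m x * transferMatrix a b (m + 1) j x := by
  rw [transferMatrix, transferMatrix, Matrix.mul_assoc (a (m + 1)), ← Matrix.mul_assoc _ (a (m + 1)),
    Matrix.mul_assoc (a m) _ (a (m + 1)), ← matrixOP_ratio_eq ha,
    show m + (j + 1) = m + 1 + j by ring]
  have h := Matrix.nonsing_inv_mul_cancel_left _ (matrixOP a b (m + 1 + j) x)⁻¹ (h1 (m + 1))
  conv_lhs => rw [← h]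
  simp only [Matrix.mul_assoc]

theorem norm_transferMatrix_sq_le (ha : ∀ n, 1 ≤ n → IsUnit (a n))
    (hb : ∀ n, (b n).IsHermitian)
    {M : ℝ} (hzeros : ∀ (n : ℕ) (x : ℂ), (matrixOP a b n x).det = 0 → x ∈ realSegment M)
    {c : ℝ} (hc : ∀ n, ‖a n‖ ≤ c) (hc' : ∀ n, ‖(a n)⁻¹‖ ≤ c)
    {x : ℂ} {d : ℝ} (hd0 : 0 < d) (hd : ∀ t ∈ realSegment M, d ≤ ‖x - t‖) (m j : ℕ) :
    ‖transferMatrix a b m j x‖ ^ 2 ≤ c ^ 4 * (1 + c ^ 2 / d ^ 2)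
      * ((c ^ 2 / d ^ 2) / (1 + c ^ 2 / d ^ 2)) ^ j := by
  have h := norm_matrixOP_mul_inv_sq_le ha hb hzeros hc hd0 hd m j
  have hc0 : 0 ≤ c := (norm_nonneg _).trans (hc 0)
  set Q := matrixOP a b m x * (matrixOP a b (m + j) x)⁻¹
  have h2 : ‖transferMatrix a b m j x‖ ≤ c * ‖Q‖ * c := by
    refine (norm_mul_le _ _).trans ?_
    gcongr
    · refine (norm_mul_le _ _).trans ?_
      gcongr
      exact hc m
    · exact hc' _
  calc ‖transferMatrix a b m j x‖ ^ 2 ≤ (c * ‖Q‖ * c) ^ 2 := by gcongr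
    _ = c ^ 4 * ‖Q‖ ^ 2 := by ring
    _ ≤ _ := by
      rw [mul_assoc]
      gcongr

/-- A telescoping estimate. -/
theorem norm_le_of_geometric_increments {E : Type*} [NormedAddCommGroup E] (S : ℕ → E)
    {C D θ : ℝ} (hθ0 : 0 ≤ θ) (hθ1 : θ < 1) (hD : 0 ≤ D) (k : ℕ) (h0 : ‖S 0‖ ≤ C * θ ^ k)
    (hS : ∀ j < k, ‖S (j + 1) - S j‖ ≤ D * θ ^ (k - 1 - j)) :
    ‖S k‖ ≤ C * θ ^ k + D / (1 - θ) := by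
  have h1 : S k = S 0 + ∑ j ∈ Finset.range k, (S (j + 1) - S j) := by
    rw [Finset.sum_range_sub]
    abel
  rw [h1]
  refine (norm_add_le _ _).trans (add_le_add h0 ?_)
  refine (norm_sum_le_of_le _ fun j hj => hS j (Finset.mem_range.1 hj)).trans ?_
  rw [← Finset.mul_sum, Finset.sum_range_reflect (fun i => θ ^ i), div_eq_mul_inv]
  gcongr
  rw [← tsum_geometric_of_lt_one hθ0 hθ1]
  exact (summable_geometric_of_lt_one hθ0 hθ1).sum_le_tsum _ fun _ _ => by positivity

theorem mul_norm_le_of_sq_le {s t u : ℝ} (h1 : s ^ 2 ≤ u) (h2 : t ^ 2 ≤ u) : s * t ≤ u := by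
  nlinarith [sq_nonneg (s - t)]

end Weyl

/-! ### Uniform Cauchy estimate for the ratios. -/

section Cauchy

open scoped Matrix.Norms.L2Operator

variable {r : ℕ} {a b : ℕ → Matrix (Fin r) (Fin r) ℂ}

theorem star_mem_realSegment_iff {M : ℝ} {x : ℂ} : star x ∈ realSegment M ↔ x ∈ realSegment M := by
  have h : ∀ y : ℂ, y ∈ realSegment M → star y ∈ realSegment M := by
    rintro _ ⟨t, ht, rfl⟩
    exact ⟨t, ht, (Complex.conj_ofReal t).symm⟩
  exact ⟨fun hx => by simpa using h _ hx, h x⟩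

theorem le_norm_star_sub {M d : ℝ} {x : ℂ} (hd : ∀ t ∈ realSegment M, d ≤ ‖x - t‖) :
    ∀ t ∈ realSegment M, d ≤ ‖star x - t‖ := fun t ht => by
  have h := hd _ (star_mem_realSegment_iff.2 ht)
  rwa [← norm_star, star_sub, star_star] at h

theorem not_mem_realSegment_of_le {M d : ℝ} (hd0 : 0 < d) {x : ℂ}
    (hd : ∀ t ∈ realSegment M, d ≤ ‖x - t‖) : x ∉ realSegment M := fun h => by
  have := hd x h
  rw [sub_self, norm_zero] at this
  exact absurd this (not_le.2 hd0)

theorem exists_pos_le_norm_sub {M : ℝ} {K : Set ℂ} (hK : IsCompact K)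
    (hKM : ∀ x ∈ K, x ∉ realSegment M) :
    ∃ d : ℝ, 0 < d ∧ ∀ x ∈ K, ∀ t ∈ realSegment M, d ≤ ‖x - t‖ := by
  have hs : IsCompact (realSegment M) := isCompact_Icc.image Complex.continuous_ofReal
  obtain ⟨d, hd, h⟩ := Metric.exists_pos_forall_lt_edist hK hs.isClosed
    (Set.disjoint_left.2 hKM)
  refine ⟨d, hd, fun x hx t ht => ?_⟩
  have := h x hx t ht
  rw [edist_nndist, ENNReal.coe_lt_coe] at this
  rw [← dist_eq_norm]
  exact_mod_cast this.le

theorem norm_weylRatio_le (ha : ∀ n, 1 ≤ n → IsUnit (a n)) (hb : ∀ n, (b n).IsHermitian)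
    {M : ℝ} (hzeros : ∀ (n : ℕ) (x : ℂ), (matrixOP a b n x).det = 0 → x ∈ realSegment M)
    {c : ℝ} (hc : ∀ n, ‖a n‖ ≤ c) (hc' : ∀ n, ‖(a n)⁻¹‖ ≤ c)
    {x : ℂ} {d : ℝ} (hd0 : 0 < d) (hd : ∀ t ∈ realSegment M, d ≤ ‖x - t‖) (n : ℕ) :
    ‖weylRatio a b n x‖ ≤ (1 + c ^ 2 / d ^ 2) * c := by
  have h := norm_matrixOP_mul_inv_sq_le ha hb hzeros hc hd0 hd n 1
  have hc0 : 0 ≤ c := (norm_nonneg _).trans (hc 0)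
  set γ := c ^ 2 / d ^ 2
  have hγ : 0 ≤ γ := by positivity
  rw [pow_one, mul_div_cancel₀ _ (by positivity)] at h
  refine (norm_mul_le _ _).trans ?_
  gcongr
  -- From `‖Q‖² ≤ γ` follows the cruder but root-free bound `‖Q‖ ≤ 1 + γ`.
  · nlinarith [norm_nonneg (matrixOP a b n x * (matrixOP a b (n + 1) x)⁻¹)]
  · exact hc' _

theorem norm_weylError_le {x : ℂ} {c ω : ℝ} (hc : ∀ n, ‖a n‖ ≤ c)
    (hω : ∀ n, ‖weylRatio a b n x‖ ≤ ω) (n m : ℕ) :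
    ‖weylError a b n m x‖ ≤ ‖b (n + 1) - b (m + 1)‖ + 2 * (c * ω) * ‖a (n + 1) - a (m + 1)‖ := by
  have hc0 : 0 ≤ c := (norm_nonneg _).trans (hc 0)
  have hω0 : 0 ≤ ω := (norm_nonneg _).trans (hω 0)
  have h1 : ‖(a (n + 1)).conjTranspose * weylRatio a b n x * (a (n + 1) - a (m + 1))‖
      ≤ c * ω * ‖a (n + 1) - a (m + 1)‖ := by
    refine (norm_mul_le _ _).trans ?_
    gcongr
    refine (norm_mul_le _ _).trans ?_
    rw [Matrix.l2_opNorm_conjTranspose]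
    exact mul_le_mul (hc _) (hω _) (norm_nonneg _) hc0
  have h2 : ‖(a (n + 1) - a (m + 1)).conjTranspose * weylRatio a b m x * a (m + 1)‖
      ≤ ‖a (n + 1) - a (m + 1)‖ * ω * c := by
    refine (norm_mul_le _ _).trans ?_
    refine mul_le_mul ?_ (hc _) (norm_nonneg _) (by positivity)
    refine (norm_mul_le _ _).trans ?_
    rw [Matrix.l2_opNorm_conjTranspose]
    gcongr
    exact hω _
  refine (norm_add_le _ _).trans ?_
  refine (add_le_add (norm_add_le _ _) le_rfl).trans ?_
  linarith

/-- Running both continued fractions `k` steps damps the initial difference by `θ ^ k`. The error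
made at each step is damped by the steps after it, so the errors sum to a geometric series. One
factor `θ ^ (j / 2)` comes from each side of the sandwich. -/
theorem norm_weylRatio_sub_le (ha : ∀ n, 1 ≤ n → IsUnit (a n)) (hb : ∀ n, (b n).IsHermitian)
    {M : ℝ} (hzeros : ∀ (n : ℕ) (x : ℂ), (matrixOP a b n x).det = 0 → x ∈ realSegment M)
    {c : ℝ} (hc : ∀ n, ‖a n‖ ≤ c) (hc' : ∀ n, ‖(a n)⁻¹‖ ≤ c)
    {x : ℂ} {d : ℝ} (hd0 : 0 < d) (hd : ∀ t ∈ realSegment M, d ≤ ‖x - t‖)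
    {γ θ ω e : ℝ} (hγ : γ = c ^ 2 / d ^ 2) (hθ : θ = γ / (1 + γ)) (hω : ω = (1 + γ) * c)
    (n m : ℕ) (k : ℕ) (he0 : 0 ≤ e) (he : ∀ j, ‖weylError a b (n + j) (m + j) x‖ ≤ e) :
    ‖weylRatio a b (n + k) x - weylRatio a b (m + k) x‖
      ≤ c ^ 4 * (1 + γ) * (2 * ω) * θ ^ k + c ^ 4 * (1 + γ) * (ω * e * ω) / (1 - θ) := by
  have hc0 : 0 ≤ c := (norm_nonneg _).trans (hc 0)
  have hγ0 : 0 ≤ γ := hγ ▸ by positivity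
  have hθ0 : 0 ≤ θ := hθ ▸ by positivity
  have hω0 : 0 ≤ ω := hω ▸ by positivity
  have hθ1 : θ < 1 := by
    rw [hθ, div_lt_one (by positivity)]
    linarith
  have hds := le_norm_star_sub hd
  have hx := not_mem_realSegment_of_le hd0 hd
  have hxs := not_mem_realSegment_of_le hd0 hds
  have h1 : ∀ n, IsUnit (matrixOP a b n x).det := fun n =>
    isUnit_iff_ne_zero.2 fun h => hx (hzeros _ _ h)
  have h2 : ∀ n, IsUnit (matrixOP a b n (star x)).det := fun n =>
    isUnit_iff_ne_zero.2 fun h => hxs (hzeros _ _ h)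
  have hT := norm_transferMatrix_sq_le ha hb hzeros hc hc' hd0 hd
  have hTs := norm_transferMatrix_sq_le ha hb hzeros hc hc' hd0 hds
  have hW := norm_weylRatio_le ha hb hzeros hc hc' hd0 hd
  rw [← hγ, ← hθ] at hT hTs
  rw [← hγ, ← hω] at hW
  have hsand : ∀ (p q j : ℕ) (Q : Matrix (Fin r) (Fin r) ℂ) (B : ℝ), ‖Q‖ ≤ B →
      ‖(transferMatrix a b p j (star x)).conjTranspose * Q * transferMatrix a b q j x‖
        ≤ c ^ 4 * (1 + γ) * B * θ ^ j := by
    intro p q j Q B hQ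
    have h3 := mul_norm_le_of_sq_le (hTs p j) (hT q j)
    calc _ ≤ ‖(transferMatrix a b p j (star x)).conjTranspose‖ * ‖Q‖ * ‖transferMatrix a b q j x‖ :=
          (norm_mul_le _ _).trans (mul_le_mul_of_nonneg_right (norm_mul_le _ _) (norm_nonneg _))
      _ = (‖transferMatrix a b p j (star x)‖ * ‖transferMatrix a b q j x‖) * ‖Q‖ := by
          rw [Matrix.l2_opNorm_conjTranspose]
          ring
      _ ≤ (c ^ 4 * (1 + γ) * θ ^ j) * B := by gcongr
      _ = _ := by ring
  -- `S j` is the difference after `j` steps, propagated through the remaining `k - j` steps without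
  -- errors. Its increments therefore contain only the `weylError` terms.
  let S : ℕ → Matrix (Fin r) (Fin r) ℂ := fun j =>
    (transferMatrix a b (n + j + 1) (k - j) (star x)).conjTranspose
      * (weylRatio a b (n + j) x - weylRatio a b (m + j) x)
      * transferMatrix a b (m + j + 1) (k - j) x
  have hk : S k = weylRatio a b (n + k) x - weylRatio a b (m + k) x := by
    simp only [S, Nat.sub_self]
    rw [transferMatrix_zero ha x h1 _ (by omega), transferMatrix_zero ha _ h2 _ (by omega)]
    simp
  rw [← hk]
  refine norm_le_of_geometric_increments S hθ0 hθ1 (by positivity) k ?_ fun j hj => ?_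
  · refine hsand _ _ _ _ _ ((norm_sub_le _ _).trans ?_)
    linarith [hW (n + 0), hW (m + 0)]
  · obtain ⟨i, rfl⟩ : ∃ i, k = j + i + 1 := ⟨k - 1 - j, by omega⟩
    have hS : S (j + 1) - S j = (transferMatrix a b (n + (j + 1) + 1) i (star x)).conjTranspose
        * (weylRatio a b (n + j + 1) x * weylError a b (n + j) (m + j) x
          * weylRatio a b (m + j + 1) x) * transferMatrix a b (m + (j + 1) + 1) i x := by
      simp only [S]
      rw [show j + i + 1 - (j + 1) = i by omega, show j + i + 1 - j = i + 1 by omega,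
        transferMatrix_succ ha x h1, transferMatrix_succ ha _ h2, Matrix.conjTranspose_mul,
        Matrix.conjTranspose_mul, conjTranspose_weylRatio ha hb _ h2 (by simpa using h1), star_star]
      simp only [← add_assoc]
      rw [weylRatio_sub_succ ha x h1]
      noncomm_ring
    rw [hS, show j + i + 1 - 1 - j = i by omega]
    refine hsand _ _ _ _ _ ?_
    refine (norm_mul_le _ _).trans ?_
    refine mul_le_mul ?_ (hW _) (norm_nonneg _) (by positivity)
    refine (norm_mul_le _ _).trans ?_
    exact mul_le_mul (hW _) (he _) (norm_nonneg _) hω0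

theorem exists_norm_le_of_tendsto {E : Type*} [NormedAddCommGroup E] {f : ℕ → E} {l : E}
    (h : Tendsto f atTop (𝓝 l)) : ∃ c, ∀ n, ‖f n‖ ≤ c := by
  obtain ⟨c, hc⟩ := (Metric.isBounded_range_of_tendsto f h).exists_norm_le
  exact ⟨c, fun n => hc _ ⟨n, rfl⟩⟩

theorem Matrix.tendsto_nonsing_inv {f : ℕ → Matrix (Fin r) (Fin r) ℂ}
    {Q : Matrix (Fin r) (Fin r) ℂ} (hQ : IsUnit Q) (h : Tendsto f atTop (𝓝 Q)) :
    Tendsto (fun n => (f n)⁻¹) atTop (𝓝 Q⁻¹) := by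
  obtain ⟨u, rfl⟩ := hQ
  have := (NormedRing.inverse_continuousAt u).tendsto.comp h
  simpa only [Matrix.nonsing_inv_eq_ringInverse, Function.comp_def] using this

/-- Convergent sequences are bounded from the first term on, so `a 0`, which may be singular, and
its possibly default inverse are covered too. -/
theorem exists_norm_coeff_le {A : Matrix (Fin r) (Fin r) ℂ} (hA : IsUnit A)
    (haA : Tendsto a atTop (𝓝 A)) : ∃ c, (∀ n, ‖a n‖ ≤ c) ∧ ∀ n, ‖(a n)⁻¹‖ ≤ c := by
  obtain ⟨c1, h1⟩ := exists_norm_le_of_tendsto haA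
  obtain ⟨c2, h2⟩ := exists_norm_le_of_tendsto (Matrix.tendsto_nonsing_inv hA haA)
  exact ⟨max c1 c2, fun n => (h1 n).trans (le_max_left _ _), fun n => (h2 n).trans (le_max_right _ _)⟩

theorem exists_norm_sub_lt_of_tendsto {f : ℕ → Matrix (Fin r) (Fin r) ℂ}
    {l : Matrix (Fin r) (Fin r) ℂ} (h : Tendsto f atTop (𝓝 l)) {ε : ℝ} (hε : 0 < ε) :
    ∃ N, ∀ n ≥ N, ∀ m ≥ N, ‖f n - f m‖ ≤ ε := by
  obtain ⟨N, hN⟩ := Metric.cauchySeq_iff.1 h.cauchySeq ε hε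
  exact ⟨N, fun n hn m hm => by simpa [dist_eq_norm] using (hN n hn m hm).le⟩

theorem uniform_cauchy_weylRatio (ha : ∀ n, 1 ≤ n → IsUnit (a n)) (hb : ∀ n, (b n).IsHermitian)
    {A B : Matrix (Fin r) (Fin r) ℂ} (hA : IsUnit A)
    (haA : Tendsto a atTop (𝓝 A)) (hbB : Tendsto b atTop (𝓝 B))
    {M : ℝ} (hzeros : ∀ (n : ℕ) (x : ℂ), (matrixOP a b n x).det = 0 → x ∈ realSegment M)
    {K : Set ℂ} {d : ℝ} (hd0 : 0 < d) (hd : ∀ x ∈ K, ∀ t ∈ realSegment M, d ≤ ‖x - t‖)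
    {ε : ℝ} (hε : 0 < ε) :
    ∃ N, ∀ n ≥ N, ∀ m ≥ N, ∀ x ∈ K, ‖weylRatio a b n x - weylRatio a b m x‖ < ε := by
  obtain ⟨c, hc, hc'⟩ := exists_norm_coeff_le hA haA
  have hc0 : 0 ≤ c := (norm_nonneg _).trans (hc 0)
  set γ := c ^ 2 / d ^ 2 with hγ
  set θ := γ / (1 + γ) with hθ
  set ω := (1 + γ) * c with hω
  have hγ0 : 0 ≤ γ := by positivity
  have hθ0 : 0 ≤ θ := by positivity
  have hθ1 : θ < 1 := by
    rw [hθ, div_lt_one (by positivity)]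
    linarith
  have hω0 : 0 ≤ ω := by positivity
  set C1 := c ^ 4 * (1 + γ) * (2 * ω)
  have hC1 : 0 ≤ C1 := by positivity
  set C2 := c ^ 4 * (1 + γ) * (ω * ω) / (1 - θ) with hC2
  have h1θ : 0 < 1 - θ := by linarith
  have hC20 : 0 ≤ C2 := by positivity
  -- The number of steps `k` is fixed to damp the initial difference, and the tolerance `e` for the
  -- coefficients is chosen afterwards.
  obtain ⟨k, hk⟩ : ∃ k, C1 * θ ^ k < ε / 2 := by
    have := ((tendsto_pow_atTop_nhds_zero_of_lt_one hθ0 hθ1).const_mul C1).eventually_lt_const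
      (show C1 * 0 < ε / 2 by simpa using half_pos hε)
    exact this.exists
  set e := ε / 2 / (C2 + 1) with he
  have he0 : 0 < e := by positivity
  obtain ⟨N1, hN1⟩ := exists_norm_sub_lt_of_tendsto hbB (half_pos he0)
  obtain ⟨N2, hN2⟩ := exists_norm_sub_lt_of_tendsto haA
    (show 0 < e / 2 / (2 * (c * ω) + 1) by positivity)
  refine ⟨max N1 N2 + k, fun n hn m hm x hx => ?_⟩
  obtain ⟨n, rfl⟩ : ∃ n', n = n' + k := ⟨n - k, by omega⟩
  obtain ⟨m, rfl⟩ : ∃ m', m = m' + k := ⟨m - k, by omega⟩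
  have hn' : max N1 N2 ≤ n := by omega
  have hm' : max N1 N2 ≤ m := by omega
  have hW := norm_weylRatio_le ha hb hzeros hc hc' hd0 (hd x hx)
  rw [← hγ, ← hω] at hW
  have herr : ∀ j, ‖weylError a b (n + j) (m + j) x‖ ≤ e := by
    intro j
    refine (norm_weylError_le hc hW _ _).trans ?_
    have h1 := hN1 (n + j + 1) (by have := le_max_left N1 N2; omega) (m + j + 1)
      (by have := le_max_left N1 N2; omega)
    have h2 := hN2 (n + j + 1) (by have := le_max_right N1 N2; omega) (m + j + 1)
      (by have := le_max_right N1 N2; omega)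
    have h3 : 2 * (c * ω) * ‖a (n + j + 1) - a (m + j + 1)‖ ≤ e / 2 := by
      rw [le_div_iff₀ (by positivity)] at h2
      nlinarith [norm_nonneg (a (n + j + 1) - a (m + j + 1))]
    linarith
  have h := norm_weylRatio_sub_le ha hb hzeros hc hc' hd0 (hd x hx) hγ hθ hω n m k he0.le herr
  have h4 : c ^ 4 * (1 + γ) * (ω * e * ω) / (1 - θ) = C2 * e := by
    rw [hC2]
    ring
  have h5 : C2 * e ≤ ε / 2 := by
    rw [he, mul_div_assoc', div_le_iff₀ (by positivity)]
    nlinarith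
  linarith

end Cauchy

/-! ### The limit matrix, its equation and its spectrum. -/

section Limit

open scoped Matrix.Norms.L2Operator

variable {r : ℕ} {a b : ℕ → Matrix (Fin r) (Fin r) ℂ} {A B : Matrix (Fin r) (Fin r) ℂ}

theorem exists_pos_le_norm_sub_of_not_mem {M : ℝ} {x : ℂ} (hx : x ∉ realSegment M) :
    ∃ d : ℝ, 0 < d ∧ ∀ t ∈ realSegment M, d ≤ ‖x - t‖ := by
  obtain ⟨d, hd, h⟩ := exists_pos_le_norm_sub (M := M) (isCompact_singleton (x := x))
    (by simpa using hx)
  exact ⟨d, hd, h x rfl⟩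

/-- The limit of the ratios `P_n(x) P_{n+1}(x)⁻¹ A_{n+1}⁻¹`. -/
noncomputable def weylLimit (a b : ℕ → Matrix (Fin r) (Fin r) ℂ) (x : ℂ) :
    Matrix (Fin r) (Fin r) ℂ :=
  limUnder atTop fun n => weylRatio a b n x

theorem tendsto_weylRatio (ha : ∀ n, 1 ≤ n → IsUnit (a n)) (hb : ∀ n, (b n).IsHermitian)
    (hA : IsUnit A) (haA : Tendsto a atTop (𝓝 A)) (hbB : Tendsto b atTop (𝓝 B))
    {M : ℝ} (hzeros : ∀ (n : ℕ) (x : ℂ), (matrixOP a b n x).det = 0 → x ∈ realSegment M)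
    {x : ℂ} (hx : x ∉ realSegment M) :
    Tendsto (fun n => weylRatio a b n x) atTop (𝓝 (weylLimit a b x)) := by
  obtain ⟨d, hd0, hd⟩ := exists_pos_le_norm_sub_of_not_mem hx
  have hC : CauchySeq fun n => weylRatio a b n x := by
    refine Metric.cauchySeq_iff.2 fun ε hε => ?_
    obtain ⟨N, hN⟩ := uniform_cauchy_weylRatio ha hb hA haA hbB hzeros (K := {x}) hd0
      (by simpa using hd) hε
    exact ⟨N, fun n hn m hm => by simpa [dist_eq_norm] using hN n hn m hm x rfl⟩
  exact hC.tendsto_limUnder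

theorem tendsto_matrixOP_ratio (ha : ∀ n, 1 ≤ n → IsUnit (a n)) (hb : ∀ n, (b n).IsHermitian)
    (hA : IsUnit A) (haA : Tendsto a atTop (𝓝 A)) (hbB : Tendsto b atTop (𝓝 B))
    {M : ℝ} (hzeros : ∀ (n : ℕ) (x : ℂ), (matrixOP a b n x).det = 0 → x ∈ realSegment M)
    {x : ℂ} (hx : x ∉ realSegment M) :
    Tendsto (fun n => matrixOP a b n x * (matrixOP a b (n + 1) x)⁻¹) atTop
      (𝓝 (weylLimit a b x * A)) := by
  simp only [matrixOP_ratio_eq ha]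
  exact (tendsto_weylRatio ha hb hA haA hbB hzeros hx).mul ((tendsto_add_atTop_iff_nat 1).2 haA)

theorem tendstoUniformlyOn_matrixOP_ratio (ha : ∀ n, 1 ≤ n → IsUnit (a n))
    (hb : ∀ n, (b n).IsHermitian)
    (hA : IsUnit A) (haA : Tendsto a atTop (𝓝 A)) (hbB : Tendsto b atTop (𝓝 B))
    {M : ℝ} (hzeros : ∀ (n : ℕ) (x : ℂ), (matrixOP a b n x).det = 0 → x ∈ realSegment M)
    {K : Set ℂ} (hK : IsCompact K) (hKM : ∀ x ∈ K, x ∉ realSegment M) :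
    TendstoUniformlyOn (fun (n : ℕ) (x : ℂ) => matrixOP a b n x * (matrixOP a b (n + 1) x)⁻¹)
      (fun x => weylLimit a b x * A) atTop K := by
  obtain ⟨d, hd0, hd⟩ := exists_pos_le_norm_sub hK hKM
  obtain ⟨c, hc, hc'⟩ := exists_norm_coeff_le hA haA
  have hc0 : 0 ≤ c := (norm_nonneg _).trans (hc 0)
  refine UniformCauchySeqOn.tendstoUniformlyOn_of_tendsto (Metric.uniformCauchySeqOn_iff.2
    fun ε hε => ?_) fun x hx => tendsto_matrixOP_ratio ha hb hA haA hbB hzeros (hKM x hx)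
  set ω := (1 + c ^ 2 / d ^ 2) * c
  have hω0 : 0 ≤ ω := by positivity
  obtain ⟨N1, hN1⟩ := uniform_cauchy_weylRatio ha hb hA haA hbB hzeros hd0 hd
    (show 0 < ε / 2 / (c + 1) by positivity)
  obtain ⟨N2, hN2⟩ := exists_norm_sub_lt_of_tendsto haA (show 0 < ε / 2 / (ω + 1) by positivity)
  refine ⟨max N1 N2, fun m hm n hn x hx => ?_⟩
  have hW := norm_weylRatio_le ha hb hzeros hc hc' hd0 (hd x hx) n
  have h1 := hN1 m (le_trans (le_max_left _ _) hm) n (le_trans (le_max_left _ _) hn) x hx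
  have h2 := hN2 (m + 1) (by have := le_max_right N1 N2; omega) (n + 1)
    (by have := le_max_right N1 N2; omega)
  rw [lt_div_iff₀ (by positivity)] at h1
  rw [le_div_iff₀ (by positivity)] at h2
  rw [dist_eq_norm, matrixOP_ratio_eq ha, matrixOP_ratio_eq ha,
    show weylRatio a b m x * a (m + 1) - weylRatio a b n x * a (n + 1)
      = (weylRatio a b m x - weylRatio a b n x) * a (m + 1)
        + weylRatio a b n x * (a (m + 1) - a (n + 1)) by noncomm_ring]
  have h3 : ‖(weylRatio a b m x - weylRatio a b n x) * a (m + 1)‖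
      ≤ ‖weylRatio a b m x - weylRatio a b n x‖ * c :=
    (norm_mul_le _ _).trans (mul_le_mul_of_nonneg_left (hc _) (norm_nonneg _))
  have h4 : ‖weylRatio a b n x * (a (m + 1) - a (n + 1))‖ ≤ ω * ‖a (m + 1) - a (n + 1)‖ :=
    (norm_mul_le _ _).trans (mul_le_mul_of_nonneg_right hW (norm_nonneg _))
  refine (norm_add_le _ _).trans_lt ?_
  nlinarith [norm_nonneg (weylRatio a b m x - weylRatio a b n x),
    norm_nonneg (a (m + 1) - a (n + 1))]

/-- The limit of the ratios solves the stationary continued fraction equation. -/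
theorem weylLimit_mul (ha : ∀ n, 1 ≤ n → IsUnit (a n)) (hb : ∀ n, (b n).IsHermitian)
    (hA : IsUnit A) (haA : Tendsto a atTop (𝓝 A)) (hbB : Tendsto b atTop (𝓝 B))
    {M : ℝ} (hzeros : ∀ (n : ℕ) (x : ℂ), (matrixOP a b n x).det = 0 → x ∈ realSegment M)
    {x : ℂ} (hx : x ∉ realSegment M) :
    weylLimit a b x * (x • (1 : Matrix (Fin r) (Fin r) ℂ) - B
      - A.conjTranspose * weylLimit a b x * A) = 1 := by
  have hW := tendsto_weylRatio ha hb hA haA hbB hzeros hx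
  have ha1 := (tendsto_add_atTop_iff_nat 1).2 haA
  have hb1 := (tendsto_add_atTop_iff_nat 1).2 hbB
  have h1 : ∀ n, IsUnit (matrixOP a b n x).det := fun n =>
    isUnit_iff_ne_zero.2 fun h => hx (hzeros _ _ h)
  have has : Tendsto (fun n => (a (n + 1)).conjTranspose) atTop (𝓝 A.conjTranspose) :=
    (continuous_star.tendsto A).comp ha1
  have h := ((tendsto_add_atTop_iff_nat 1).2 hW).mul
    ((tendsto_const_nhds (x := x • (1 : Matrix (Fin r) (Fin r) ℂ))).sub hb1 |>.sub
      ((has.mul hW).mul ha1))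
  simp only [weylRatio_succ_mul ha x h1] at h
  exact tendsto_nhds_unique h tendsto_const_nhds

theorem conjTranspose_weylLimit (ha : ∀ n, 1 ≤ n → IsUnit (a n)) (hb : ∀ n, (b n).IsHermitian)
    (hA : IsUnit A) (haA : Tendsto a atTop (𝓝 A)) (hbB : Tendsto b atTop (𝓝 B))
    {M : ℝ} (hzeros : ∀ (n : ℕ) (x : ℂ), (matrixOP a b n x).det = 0 → x ∈ realSegment M)
    {x : ℂ} (hx : x ∉ realSegment M) :
    (weylLimit a b x).conjTranspose = weylLimit a b (star x) := by
  have hxs : star x ∉ realSegment M := fun h => hx (star_mem_realSegment_iff.1 h)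
  have h1 := (continuous_star.tendsto _).comp (tendsto_weylRatio ha hb hA haA hbB hzeros hx)
  refine tendsto_nhds_unique h1 ?_
  refine (tendsto_weylRatio ha hb hA haA hbB hzeros hxs).congr fun n => ?_
  exact (conjTranspose_weylRatio ha hb x (fun n => isUnit_iff_ne_zero.2 fun h => hx (hzeros _ _ h))
    (fun n => isUnit_iff_ne_zero.2 fun h => hxs (hzeros _ _ h)) n).symm

/-- The product of `k` consecutive ratios telescopes to `P_n P_{n+k}⁻¹` and tends to the `k`-th
power of the limit, so the decay bound, uniform in `n`, passes to the powers. -/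
theorem exists_norm_pow_sq_le (ha : ∀ n, 1 ≤ n → IsUnit (a n)) (hb : ∀ n, (b n).IsHermitian)
    (hA : IsUnit A) (haA : Tendsto a atTop (𝓝 A)) (hbB : Tendsto b atTop (𝓝 B))
    {M : ℝ} (hzeros : ∀ (n : ℕ) (x : ℂ), (matrixOP a b n x).det = 0 → x ∈ realSegment M)
    {x : ℂ} (hx : x ∉ realSegment M) :
    ∃ C θ : ℝ, 0 ≤ θ ∧ θ < 1 ∧ ∀ k : ℕ, ‖(weylLimit a b x * A) ^ k‖ ^ 2 ≤ C * θ ^ k := by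
  obtain ⟨d, hd0, hd⟩ := exists_pos_le_norm_sub_of_not_mem hx
  obtain ⟨c, hc, -⟩ := exists_norm_coeff_le hA haA
  have hlim : ∀ k : ℕ, Tendsto (fun n => matrixOP a b n x * (matrixOP a b (n + k) x)⁻¹) atTop
      (𝓝 ((weylLimit a b x * A) ^ k)) := by
    have h1 : ∀ n, IsUnit (matrixOP a b n x).det := fun n =>
      isUnit_iff_ne_zero.2 fun h => hx (hzeros _ _ h)
    intro k
    induction k with
    | zero => simp [Matrix.mul_nonsing_inv _ (h1 _)]
    | succ k ih =>
      have h2 := ih.mul ((tendsto_add_atTop_iff_nat k).2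
        (tendsto_matrixOP_ratio ha hb hA haA hbB hzeros hx))
      rw [pow_succ]
      refine h2.congr fun n => ?_
      rw [Matrix.mul_assoc, Matrix.nonsing_inv_mul_cancel_left _ _ (h1 _)]
      rfl
  refine ⟨1 + c ^ 2 / d ^ 2, (c ^ 2 / d ^ 2) / (1 + c ^ 2 / d ^ 2), by positivity, ?_, fun k => ?_⟩
  · rw [div_lt_one (by positivity)]
    linarith
  · exact le_of_tendsto ((hlim k).norm.pow 2)
      (Eventually.of_forall fun n => norm_matrixOP_mul_inv_sq_le ha hb hzeros hc hd0 hd n k)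

theorem norm_lt_one_of_mulVec_eq_smul {R : Matrix (Fin r) (Fin r) ℂ}
    (hR : ∃ C θ : ℝ, 0 ≤ θ ∧ θ < 1 ∧ ∀ k : ℕ, ‖R ^ k‖ ^ 2 ≤ C * θ ^ k)
    {μ : ℂ} {v : Fin r → ℂ} (hv : v ≠ 0) (h : R.mulVec v = μ • v) : ‖μ‖ < 1 := by
  obtain ⟨C, θ, hθ0, hθ1, hC⟩ := hR
  by_contra! hμ
  have hpow : ∀ k : ℕ, (R ^ k).mulVec v = μ ^ k • v := by
    intro k
    induction k with
    | zero => simp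
    | succ k ih => rw [pow_succ, ← Matrix.mulVec_mulVec, h, Matrix.mulVec_smul, ih, smul_smul, pow_succ']
  have hv' : 0 < ‖WithLp.toLp 2 v‖ := norm_pos_iff.2 fun h0 => hv (by simpa using h0)
  have h1 : ∀ k : ℕ, 1 ≤ C * θ ^ k := by
    intro k
    have h2 := (R ^ k).l2_opNorm_mulVec (WithLp.toLp 2 v)
    rw [show (R ^ k).mulVec (WithLp.toLp 2 v).ofLp = μ ^ k • v from hpow k] at h2
    have h3 : ‖μ ^ k‖ * ‖WithLp.toLp 2 v‖ ≤ ‖R ^ k‖ * ‖WithLp.toLp 2 v‖ := by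
      rw [← norm_smul]
      exact h2
    have h4 : 1 ≤ ‖R ^ k‖ := by
      refine le_trans ?_ (le_of_mul_le_mul_right h3 hv')
      rw [norm_pow]
      exact one_le_pow₀ hμ
    exact (one_le_pow₀ h4).trans (hC k)
  have h5 := (tendsto_pow_atTop_nhds_zero_of_lt_one hθ0 hθ1).const_mul C
  have h6 := ge_of_tendsto' h5 h1
  rw [mul_zero] at h6
  exact absurd h6 (not_le.2 one_pos)

/-- The cofactor of `z - R` in the symbol is nonsingular in the closed unit disc. -/
theorem det_smul_sub_inv_ne_zero {W W' : Matrix (Fin r) (Fin r) ℂ} (hW : IsUnit W.det)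
    (hWW : W'.conjTranspose = W)
    (hR : ∃ C θ : ℝ, 0 ≤ θ ∧ θ < 1 ∧ ∀ k : ℕ, ‖(W' * A) ^ k‖ ^ 2 ≤ C * θ ^ k)
    {z : ℂ} (hz : ‖z‖ ≤ 1) : (z • A.conjTranspose - W⁻¹).det ≠ 0 := by
  intro h0
  have h1 : (1 - z • (W * A.conjTranspose)).det = 0 := by
    rw [show 1 - z • (W * A.conjTranspose) = -(W * (z • A.conjTranspose - W⁻¹)) by
      rw [mul_sub, Matrix.mul_nonsing_inv _ hW, Matrix.mul_smul, neg_sub], Matrix.det_neg,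
      Matrix.det_mul, h0]
    simp
  -- Take adjoints in `h1` and use `det (1 - P Q) = det (1 - Q P)`. Then `(star z)⁻¹` is an
  -- eigenvalue of `W' * A`, which forces `‖z‖ > 1`.
  have h2 : (1 - star z • (W' * A)).det = 0 := by
    rw [← Matrix.smul_mul, Matrix.det_one_sub_mul_comm]
    rw [← star_eq_zero, ← Matrix.det_conjTranspose]
    rw [← h1, ← hWW]
    simp
  obtain ⟨v, hv, hv0⟩ := Matrix.exists_mulVec_eq_zero_iff.2 h2
  rw [Matrix.sub_mulVec, Matrix.one_mulVec, Matrix.smul_mulVec, sub_eq_zero] at hv0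
  have hz0 : star z ≠ 0 := fun h => hv (by rw [hv0, h, zero_smul])
  have h3 := norm_lt_one_of_mulVec_eq_smul hR (μ := (star z)⁻¹) hv
    (by conv_rhs => rw [hv0, smul_smul, inv_mul_cancel₀ hz0, one_smul])
  rw [norm_inv, norm_star] at h3
  have hzp : 0 < ‖z‖ := norm_pos_iff.2 (by simpa using hz0)
  exact absurd hz (not_le.2 ((inv_lt_one₀ hzp).1 h3))

end Limit

/-! ### Factorization of the symbol and location of its roots. -/

section Symbol

variable {r : ℕ} {A B : Matrix (Fin r) (Fin r) ℂ}

/-- Stated over a commutative ring so that it serves both numerical `z` and the indeterminate `X`.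
-/
theorem symbol_factor_aux {R' : Type*} [CommRing R'] {n : Type*} [Fintype n] [DecidableEq n]
    (z x : R') (As B W Wi A : Matrix n n R')
    (h1 : Wi * W = 1) (h2 : Wi = x • (1 : Matrix n n R') - B - As * W * A) :
    (z • As - Wi) * (z • (1 : Matrix n n R') - W * A)
      = z ^ 2 • As + z • (B - x • (1 : Matrix n n R')) + A := by
  have h3 : Wi * (W * A) = A := by rw [← Matrix.mul_assoc, h1, Matrix.one_mul]
  rw [sub_mul, mul_sub, mul_sub, h3]
  simp only [Matrix.smul_mul, Matrix.mul_smul, mul_one, smul_smul]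
  rw [h2]
  simp only [smul_sub, Matrix.mul_assoc, pow_two]
  abel

theorem symbolPoly_eq_det_mul_charpoly {x : ℂ} {W : Matrix (Fin r) (Fin r) ℂ}
    (h : W * (x • (1 : Matrix (Fin r) (Fin r) ℂ) - B - A.conjTranspose * W * A) = 1) :
    symbolPoly A B x = ((X : ℂ[X]) • A.conjTranspose.map C - W⁻¹.map C).det
      * (W * A).charpoly := by
  have hW : IsUnit W.det := Matrix.isUnit_det_of_right_inverse h
  have hWi : W⁻¹ = x • (1 : Matrix (Fin r) (Fin r) ℂ) - B - A.conjTranspose * W * A :=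
    Matrix.inv_eq_right_inv h
  have h1 : (W⁻¹.map C : Matrix (Fin r) (Fin r) ℂ[X]) * W.map C = 1 := by
    rw [← Matrix.map_mul, Matrix.nonsing_inv_mul _ hW]
    simp
  have h2 : (W⁻¹.map C : Matrix (Fin r) (Fin r) ℂ[X])
      = (C x : ℂ[X]) • 1 - B.map C - A.conjTranspose.map C * W.map C * A.map C := by
    rw [hWi, ← Matrix.map_mul, ← Matrix.map_mul]
    ext i j : 1
    by_cases hij : i = j <;> simp [hij, -Matrix.map_mul]
  have h3 := symbol_factor_aux (X : ℂ[X]) (C x) _ _ _ _ _ h1 h2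
  rw [Matrix.charpoly, Matrix.charmatrix, ← Matrix.det_mul, symbolPoly]
  have h4 : Matrix.scalar (Fin r) (X : ℂ[X]) - (C : ℂ →+* ℂ[X]).mapMatrix (W * A)
      = (X : ℂ[X]) • 1 - W.map C * A.map C := by
    rw [map_mul, Matrix.scalar_apply, ← Matrix.smul_one_eq_diagonal]
    rfl
  rw [h4, h3]
  congr 3
  ext i j : 1
  by_cases hij : i = j <;> simp [hij]

theorem smul_symbolMatrix {z : ℂ} (hz : z ≠ 0) (x : ℂ) :
    z • symbolMatrix A B z x
      = z ^ 2 • A.conjTranspose + z • (B - x • (1 : Matrix (Fin r) (Fin r) ℂ)) + A := by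
  ext i j
  simp only [symbolMatrix, Matrix.add_apply, Matrix.sub_apply, Matrix.smul_apply, smul_eq_mul]
  field_simp
  ring

theorem symbolPoly_eval_zero (x : ℂ) : (symbolPoly A B x).eval 0 = A.det := by
  rw [symbolPoly, ← Polynomial.coe_evalRingHom, RingHom.map_det]
  congr 1
  ext i j
  simp

theorem symbolPoly_ne_zero (hA : IsUnit A) (x : ℂ) : symbolPoly A B x ≠ 0 := fun h => by
  have h1 := symbolPoly_eval_zero (A := A) (B := B) x
  rw [h, eval_zero] at h1
  exact ((Matrix.isUnit_iff_isUnit_det _).1 hA).ne_zero h1.symm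

theorem card_eq_algMult {x : ℂ} {z : Fin (2 * r) → ℂ} (hz : IsRootLabelling A B x z) (μ : ℂ) :
    Fintype.card {l // z l = μ} = algMult A B μ x := by
  rw [algMult, ← Polynomial.count_roots, ← hz.1, Multiset.count_map, Fintype.card_subtype]
  simp only [eq_comm (a := μ)]
  rfl

theorem ne_zero_of_isRootLabelling (hA : IsUnit A) {x : ℂ} {z : Fin (2 * r) → ℂ}
    (hz : IsRootLabelling A B x z) (k : Fin (2 * r)) : z k ≠ 0 := fun h => by
  have h1 : z k ∈ (symbolPoly A B x).roots := by
    rw [← hz.1]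
    exact Multiset.mem_map_of_mem _ (Finset.mem_univ k)
  have h2 := Polynomial.isRoot_of_mem_roots h1
  rw [h, IsRoot, symbolPoly_eval_zero] at h2
  exact ((Matrix.isUnit_iff_isUnit_det _).1 hA).ne_zero h2

/-- If the symbol factors through a matrix with spectrum in the open disc and a cofactor that is
nonsingular on the closed disc, then the first half of the roots lies in the open disc. -/
theorem norm_firstHalf_lt_one (hA : IsUnit A) {x : ℂ} {W : Matrix (Fin r) (Fin r) ℂ}
    (h : W * (x • (1 : Matrix (Fin r) (Fin r) ℂ) - B - A.conjTranspose * W * A) = 1)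
    (h1 : ∀ (μ : ℂ) (v : Fin r → ℂ), v ≠ 0 → (W * A).mulVec v = μ • v → ‖μ‖ < 1)
    {z : Fin (2 * r) → ℂ} (hz : IsRootLabelling A B x z) (k : Fin r) :
    ‖z (firstHalf k)‖ < 1 := by
  classical
  by_contra! hk
  set q := ((X : ℂ[X]) • A.conjTranspose.map C - W⁻¹.map C).det
  have hfac : symbolPoly A B x = q * (W * A).charpoly := symbolPoly_eq_det_mul_charpoly h
  have hne : q * (W * A).charpoly ≠ 0 := hfac ▸ symbolPoly_ne_zero hA x
  have hcard : (W * A).charpoly.roots.card = r := by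
    rw [← (IsAlgClosed.splits (W * A).charpoly).natDegree_eq_card_roots,
      Matrix.charpoly_natDegree_eq_dim, Fintype.card_fin]
  have hroot : ∀ μ ∈ (W * A).charpoly.roots, ‖μ‖ < 1 := by
    intro μ hμ
    have h3 := Polynomial.isRoot_of_mem_roots hμ
    rw [IsRoot, Matrix.eval_charpoly] at h3
    obtain ⟨v, hv, hv0⟩ := Matrix.exists_mulVec_eq_zero_iff.2 h3
    refine h1 μ v hv ?_
    rw [Matrix.sub_mulVec, sub_eq_zero] at hv0
    rw [← hv0, Matrix.scalar_apply, ← Matrix.smul_one_eq_diagonal, Matrix.smul_mulVec, Matrix.one_mulVec]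
  have hcount : r ≤ (symbolPoly A B x).roots.countP (fun μ => ‖μ‖ < 1) := by
    rw [hfac, Polynomial.roots_mul hne, Multiset.countP_add,
      Multiset.countP_eq_card.2 hroot, hcard]
    omega
  rw [← hz.1, Multiset.countP_map] at hcount
  -- If the root at position `k < r` had modulus at least one, monotonicity would leave at most `k`
  -- roots in the open disc, against the `r` supplied by the characteristic polynomial.
  have hsub : (Finset.univ.filter fun l => ‖z l‖ < 1) ⊆ Finset.Iio (firstHalf k) := by
    intro l hl
    rw [Finset.mem_filter] at hl
    rw [Finset.mem_Iio]
    by_contra! hle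
    exact absurd hl.2 (not_lt.2 (hk.trans (hz.2 hle)))
  have h2 := Finset.card_le_card hsub
  rw [Fin.card_Iio] at h2
  have h4 : r ≤ (Finset.univ.filter fun l => ‖z l‖ < 1).card := hcount
  have h5 : ((firstHalf k : Fin (2 * r)) : ℕ) = k := rfl
  have := k.2
  omega

theorem mulVec_eq_of_symbolMatrix {x : ℂ} {W : Matrix (Fin r) (Fin r) ℂ}
    (h : W * (x • (1 : Matrix (Fin r) (Fin r) ℂ) - B - A.conjTranspose * W * A) = 1)
    {z : ℂ} (hz0 : z ≠ 0) (hz : (z • A.conjTranspose - W⁻¹).det ≠ 0) {v : Fin r → ℂ}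
    (hv : (symbolMatrix A B z x).mulVec v = 0) : (W * A).mulVec v = z • v := by
  have hW : IsUnit W.det := Matrix.isUnit_det_of_right_inverse h
  have h1 := symbol_factor_aux z x A.conjTranspose B W W⁻¹ A (Matrix.nonsing_inv_mul _ hW)
    (Matrix.inv_eq_right_inv h)
  rw [← smul_symbolMatrix hz0] at h1
  have h2 := congrArg (fun Q => Q.mulVec v) h1
  simp only [Matrix.smul_mulVec, hv, smul_zero, ← Matrix.mulVec_mulVec] at h2
  have h3 := Matrix.eq_zero_of_mulVec_eq_zero hz h2
  rw [Matrix.sub_mulVec, Matrix.smul_mulVec, Matrix.one_mulVec, sub_eq_zero] at h3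
  exact h3.symm

/-- Eigenvectors that are linearly independent for each single eigenvalue are linearly
independent. -/
theorem linearIndependent_of_forall_eigenvalue {V ι : Type*} [AddCommGroup V] [Module ℂ V]
    [Fintype ι] (f : Module.End ℂ V) (v : ι → V) (μ : ι → ℂ) (hf : ∀ i, f (v i) = μ i • v i)
    (h : ∀ m, LinearIndependent ℂ fun i : {i // μ i = m} => v i) : LinearIndependent ℂ v := by
  classical
  rw [Fintype.linearIndependent_iff]
  intro g hg j
  -- Applying `p` to `f` kills every eigenvector whose eigenvalue differs from `μ j` and only
  -- rescales the others.
  set p : ℂ[X] := ∏ m ∈ (Finset.univ.image μ).erase (μ j), (X - C m) with hp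
  have hpj : p.eval (μ j) ≠ 0 := by
    rw [hp, eval_prod, Finset.prod_ne_zero_iff]
    intro m hm
    rw [eval_sub, eval_X, eval_C, sub_ne_zero]
    exact (Finset.ne_of_mem_erase hm).symm
  have hp0 : ∀ i, μ i ≠ μ j → p.eval (μ i) = 0 := by
    intro i hi
    rw [hp, eval_prod]
    exact Finset.prod_eq_zero (Finset.mem_erase.2 ⟨hi, Finset.mem_image_of_mem _ (Finset.mem_univ i)⟩)
      (by simp)
  have hact : ∀ i, aeval f p (v i) = p.eval (μ i) • v i := by
    intro i
    induction p using Polynomial.induction_on' with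
    | add p q hp hq => rw [map_add, LinearMap.add_apply, hp, hq, eval_add, add_smul]
    | monomial n c =>
      rw [aeval_monomial, eval_monomial, Module.End.mul_apply, Module.algebraMap_end_apply, mul_smul]
      congr 1
      induction n with
      | zero => simp
      | succ n ih => rw [pow_succ', Module.End.mul_apply, ih, map_smul, hf, smul_smul, pow_succ]
  have h1 := congrArg (aeval f p) hg
  rw [map_sum, map_zero] at h1
  simp only [map_smul, hact, smul_smul] at h1
  have h2 : ∑ i : {i // μ i = μ j}, (g i * p.eval (μ i)) • v i = 0 := by
    rw [← h1, ← Fintype.sum_subtype_add_sum_subtype (fun i => μ i = μ j), left_eq_add]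
    exact Finset.sum_eq_zero fun i _ => by rw [hp0 i i.2, mul_zero, zero_smul]
  have h3 := Fintype.linearIndependent_iff.1 (h (μ j)) _ h2 ⟨j, rfl⟩
  exact (mul_eq_zero.1 h3).resolve_right hpj

end Symbol

/-! ### Eigenvectors and diagonalization of the limit. -/

section Eigenvectors

variable {r : ℕ} {A B : Matrix (Fin r) (Fin r) ℂ}

/-- A root labels as many vectors as its algebraic multiplicity, which is also the dimension of
their span. -/
theorem linearIndependent_of_isNullVectorChoice {x : ℂ} {z : Fin (2 * r) → ℂ}
    {v : Fin (2 * r) → Fin r → ℂ} (hz : IsRootLabelling A B x z)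
    (hv : IsNullVectorChoice A B x z v) (μ : ℂ) :
    LinearIndependent ℂ fun l : {l // z l = μ} => v l := by
  by_cases hμ : ∃ k, z k = μ
  · obtain ⟨k, rfl⟩ := hμ
    rw [linearIndependent_iff_card_eq_finrank_span, card_eq_algMult hz, ← (hv.2.2 k).2,
      ← (hv.2.2 k).1, Set.finrank, Set.image_eq_range]
    rfl
  · have : IsEmpty {l // z l = μ} := ⟨fun l => hμ ⟨l, l.2⟩⟩
    exact linearIndependent_empty_type

theorem firstHalf_injective : Function.Injective (firstHalf (r := r)) :=
  fun k l h => Fin.castLE_injective (show r ≤ 2 * r by omega) h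

theorem linearIndependent_firstHalf {x : ℂ} {z : Fin (2 * r) → ℂ}
    {v : Fin (2 * r) → Fin r → ℂ} (hz : IsRootLabelling A B x z)
    (hv : IsNullVectorChoice A B x z v) {R : Matrix (Fin r) (Fin r) ℂ}
    (hR : ∀ k : Fin r, R.mulVec (v (firstHalf k)) = z (firstHalf k) • v (firstHalf k)) :
    LinearIndependent ℂ fun k : Fin r => v (firstHalf k) := by
  refine linearIndependent_of_forall_eigenvalue R.mulVecLin _ (fun k => z (firstHalf k)) hR
    fun m => ?_
  refine (linearIndependent_of_isNullVectorChoice hz hv m).comp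
    (fun k : {k : Fin r // z (firstHalf k) = m} => ⟨firstHalf k, k.2⟩) fun k l hkl => ?_
  exact Subtype.ext (firstHalf_injective (Subtype.ext_iff.1 hkl))

theorem matrixDiagonalizable_of_linearIndependent {R : Matrix (Fin r) (Fin r) ℂ}
    (u : Fin r → Fin r → ℂ) (d : Fin r → ℂ) (hu : LinearIndependent ℂ u)
    (h : ∀ k, R.mulVec (u k) = d k • u k) : MatrixDiagonalizable R := by
  set V : Matrix (Fin r) (Fin r) ℂ := (Matrix.of u).transpose with hV
  have hVu : IsUnit V := by
    rw [hV, Matrix.isUnit_transpose]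
    exact Matrix.linearIndependent_rows_iff_isUnit.1 hu
  have hRV : R * V = V * Matrix.diagonal d := by
    ext i k
    rw [Matrix.mul_diagonal]
    have := congrFun (h k) i
    rw [Pi.smul_apply, smul_eq_mul, mul_comm] at this
    exact this
  refine ⟨V, d, hVu, ?_⟩
  rw [← hRV, Matrix.mul_nonsing_inv_cancel_right _ _ ((Matrix.isUnit_iff_isUnit_det _).1 hVu)]

open scoped Matrix.Norms.L2Operator in
theorem weylLimit_mulVec {a b : ℕ → Matrix (Fin r) (Fin r) ℂ}
    (ha : ∀ n, 1 ≤ n → IsUnit (a n)) (hb : ∀ n, (b n).IsHermitian)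
    (hA : IsUnit A) (haA : Tendsto a atTop (𝓝 A)) (hbB : Tendsto b atTop (𝓝 B))
    {M : ℝ} (hzeros : ∀ (n : ℕ) (x : ℂ), (matrixOP a b n x).det = 0 → x ∈ realSegment M)
    {x : ℂ} (hx : x ∉ realSegment M) {z : Fin (2 * r) → ℂ}
    {v : Fin (2 * r) → Fin r → ℂ} (hz : IsRootLabelling A B x z)
    (hv : IsNullVectorChoice A B x z v) (k : Fin r) :
    (weylLimit a b x * A).mulVec (v (firstHalf k)) = z (firstHalf k) • v (firstHalf k) := by
  have hxs : star x ∉ realSegment M := fun h => hx (star_mem_realSegment_iff.1 h)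
  have h1 := weylLimit_mul ha hb hA haA hbB hzeros hx
  have hlt := norm_firstHalf_lt_one hA h1 (fun μ w hw => norm_lt_one_of_mulVec_eq_smul
    (exists_norm_pow_sq_le ha hb hA haA hbB hzeros hx) hw) hz k
  refine mulVec_eq_of_symbolMatrix h1 (ne_zero_of_isRootLabelling hA hz _) ?_ (hv.2.1 _)
  refine det_smul_sub_inv_ne_zero (Matrix.isUnit_det_of_right_inverse h1)
    (W' := weylLimit a b (star x)) ?_
    (exists_norm_pow_sq_le ha hb hA haA hbB hzeros hxs) hlt.le
  rw [conjTranspose_weylLimit ha hb hA haA hbB hzeros hxs, star_star]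

open scoped Matrix.Norms.L2Operator in
-- Only the bound on `u` enters, not continuity in `x`, so arbitrary choices of labellings and
-- vectors are allowed. Distances are in the sup norm, which the Euclidean norm dominates.
theorem tendstoUniformlyOn_mulVec {ι : Type*} {F : ℕ → ℂ → Matrix (Fin r) (Fin r) ℂ}
    {R : ℂ → Matrix (Fin r) (Fin r) ℂ} {K : Set ℂ} (h : TendstoUniformlyOn F R atTop K)
    (u : ι × ℂ → Fin r → ℂ) (hu : ∀ i, ∀ x ∈ K, ‖WithLp.toLp 2 (u (i, x))‖ ≤ 1) :
    TendstoUniformlyOn (fun n p => (F n p.2).mulVec (u p)) (fun p => (R p.2).mulVec (u p)) atTop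
      (Set.univ ×ˢ K) := by
  rw [Metric.tendstoUniformlyOn_iff] at h ⊢
  intro ε hε
  filter_upwards [h ε hε] with n hn
  rintro ⟨i, x⟩ ⟨-, hx⟩
  refine lt_of_le_of_lt ?_ (hn x hx)
  rw [dist_eq_norm, dist_eq_norm, ← Matrix.sub_mulVec]
  have h1 := (R x - F n x).l2_opNorm_mulVec (WithLp.toLp 2 (u (i, x)))
  calc ‖(R x - F n x).mulVec (u (i, x))‖
      ≤ ‖WithLp.toLp 2 ((R x - F n x).mulVec (u (i, x)))‖ := by
        refine (pi_norm_le_iff_of_nonneg (norm_nonneg _)).2 fun j => ?_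
        exact PiLp.norm_apply_le (WithLp.toLp 2 ((R x - F n x).mulVec (u (i, x)))) j
    _ ≤ ‖R x - F n x‖ * ‖WithLp.toLp 2 (u (i, x))‖ := h1
    _ ≤ ‖R x - F n x‖ * 1 := by
        gcongr
        exact hu i x hx
    _ = _ := mul_one _

end Eigenvectors

/-! ### Geometric and algebraic multiplicities of polynomial matrices. -/

section PolynomialMatrix

variable {r : ℕ}

/-- The geometric multiplicity of a root of a polynomial matrix is at most its algebraic
multiplicity. -/
theorem finrank_ker_le_rootMultiplicity_det (F : Matrix (Fin r) (Fin r) ℂ[X]) (hF : F.det ≠ 0)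
    (z : ℂ) : Module.finrank ℂ (LinearMap.ker (F.map (eval z)).mulVecLin)
      ≤ F.det.rootMultiplicity z := by
  classical
  set N := LinearMap.ker (F.map (eval z)).mulVecLin
  obtain ⟨N', hN'⟩ := Submodule.exists_isCompl N
  let bs : Module.Basis (Fin (Module.finrank ℂ N) ⊕ Fin (Module.finrank ℂ N')) ℂ (Fin r → ℂ) :=
    ((Module.finBasis ℂ N).prod (Module.finBasis ℂ N')).map (Submodule.prodEquivOfIsCompl N N' hN')
  let σ : Fin (Module.finrank ℂ N) ⊕ Fin (Module.finrank ℂ N') ≃ Fin r :=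
    bs.indexEquiv (Pi.basisFun ℂ (Fin r))
  let V : Matrix (Fin r) (Fin r) ℂ := Matrix.of fun i j => bs (σ.symm j) i
  have hV : V.det ≠ 0 := by
    rw [← isUnit_iff_ne_zero, ← Matrix.isUnit_iff_isUnit_det, ← Matrix.isUnit_transpose]
    refine Matrix.linearIndependent_rows_iff_isUnit.1 ?_
    exact bs.linearIndependent.comp _ σ.symm.injective
  -- In a basis adapted to the kernel at `z`, each kernel column of `F * V` vanishes at `z`, so one
  -- factor `X - C z` can be pulled out of it.
  let c : Fin r → ℂ[X] := fun j => Sum.elim (fun _ => X - C z) (fun _ => 1) (σ.symm j)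
  have hdvd : ∀ i j, c j ∣ (F * V.map C) i j := by
    intro i j
    rcases hj : σ.symm j with k | k
    · simp only [c, hj, Sum.elim_inl]
      rw [dvd_iff_isRoot, IsRoot]
      have hk : bs (Sum.inl k) ∈ N := by simp [bs]
      have h2 := congrFun (LinearMap.mem_ker.1 hk) i
      rw [← hj] at h2
      simpa [Matrix.mul_apply, eval_finsetSum, Matrix.mulVec, dotProduct, V] using h2
    · simp only [c, hj, Sum.elim_inr]
      exact one_dvd _
  choose G hG using hdvd
  have h1 : F * V.map C = Matrix.of fun i j => c j * Matrix.of G i j := by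
    ext1 i j
    exact hG i j
  have h2 := congrArg Matrix.det h1
  rw [Matrix.det_mul_row, Matrix.det_mul, show (V.map C).det = C V.det from
    (RingHom.map_det C V).symm] at h2
  have h3 : ∏ j, c j = (X - C z) ^ Module.finrank ℂ N := by
    rw [← σ.prod_comp]
    simp [c]
  rw [h3] at h2
  rw [le_rootMultiplicity_iff hF, ← (isUnit_C.2 (isUnit_iff_ne_zero.2 hV)).dvd_mul_right, h2]
  exact dvd_mul_right _ _

theorem le_finrank_ker_add_finrank_ker {P Q : Matrix (Fin r) (Fin r) ℂ} (h : P * Q = 0) :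
    r ≤ Module.finrank ℂ (LinearMap.ker P.mulVecLin)
      + Module.finrank ℂ (LinearMap.ker Q.mulVecLin) := by
  have h1 : LinearMap.range Q.mulVecLin ≤ LinearMap.ker P.mulVecLin := by
    rw [LinearMap.range_le_ker_iff, ← Matrix.mulVecLin_mul, h, Matrix.mulVecLin_zero]
  have h2 := Q.mulVecLin.finrank_range_add_finrank_ker
  rw [Module.finrank_fin_fun] at h2
  have := Submodule.finrank_mono h1
  omega

/-- A divisor of a scalar polynomial matrix has equal geometric and algebraic multiplicity at a
simple root of that scalar. -/
theorem finrank_ker_eq_rootMultiplicity_det {F G : Matrix (Fin r) (Fin r) ℂ[X]} {h : ℂ[X]}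
    (hFG : F * G = h • (1 : Matrix (Fin r) (Fin r) ℂ[X])) {z : ℂ} (h0 : h.eval z = 0)
    (h1 : h.derivative.eval z ≠ 0) :
    Module.finrank ℂ (LinearMap.ker (F.map (eval z)).mulVecLin) = F.det.rootMultiplicity z := by
  have hne : h ≠ 0 := fun hh => h1 (by simp [hh])
  have hdet : F.det * G.det = h ^ r := by
    rw [← Matrix.det_mul, hFG, Matrix.det_smul, Matrix.det_one, mul_one, Fintype.card_fin]
  have hdne : F.det * G.det ≠ 0 := hdet ▸ pow_ne_zero _ hne
  have hm1 : h.rootMultiplicity z = 1 := by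
    refine le_antisymm (not_lt.1 fun hlt => ?_) ((rootMultiplicity_pos hne).2 h0)
    exact h1 ((one_lt_rootMultiplicity_iff_isRoot hne).1 hlt).2
  have hm : F.det.rootMultiplicity z + G.det.rootMultiplicity z = r := by
    rw [← rootMultiplicity_mul hdne, hdet, ← count_roots, roots_pow, Multiset.count_nsmul,
      count_roots, hm1, mul_one]
  -- The kernel dimensions of `F` and `G` at `z` add up to at least `r`, since `F G` vanishes there.
  -- Their upper bounds, the multiplicities, add up to exactly `r`, so both bounds are equalities.
  have hF := finrank_ker_le_rootMultiplicity_det F (left_ne_zero_of_mul hdne) z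
  have hG := finrank_ker_le_rootMultiplicity_det G (right_ne_zero_of_mul hdne) z
  have hz : F.map (eval z) * G.map (eval z) = 0 := by
    have h2 := congrArg (fun Q => Q.map (evalRingHom z)) hFG
    rw [Matrix.map_mul] at h2
    refine h2.trans ?_
    ext i j
    by_cases hij : i = j <;> simp [hij, h0]
  have := le_finrank_ker_add_finrank_ker hz
  omega

theorem coeff_det_of_natDegree_le {R : Type*} [CommRing R] {n : Type*} [Fintype n] [DecidableEq n]
    (Q : Matrix n n R[X]) (k : ℕ) (h : ∀ i j, (Q i j).natDegree ≤ k) :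
    Q.det.natDegree ≤ Fintype.card n * k ∧
      Q.det.coeff (Fintype.card n * k) = (Q.map fun q => q.coeff k).det := by
  rw [Matrix.det_apply, Matrix.det_apply]
  constructor
  · refine natDegree_sum_le_of_forall_le _ _ fun σ _ => ?_
    refine (natDegree_smul_le _ _).trans ((natDegree_prod_le _ _).trans ?_)
    refine (Finset.sum_le_card_nsmul _ _ k fun i _ => h _ _).trans ?_
    simp
  · rw [finsetSum_coeff]
    refine Finset.sum_congr rfl fun σ _ => ?_
    rw [coeff_smul]
    congr 1
    exact coeff_prod_of_natDegree_le _ _ _ fun i _ => h _ _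

end PolynomialMatrix

/-! ### Squarefree part of a monic polynomial over a domain. -/

section SquarefreePart

/-- A monic polynomial over an integrally closed domain of characteristic zero has a monic
divisor with the same roots that is separable up to a nonzero constant. -/
theorem exists_monic_separable_part {R : Type*} [CommRing R] [IsDomain R] [IsIntegrallyClosed R]
    [CharZero R] {p : R[X]} (hp : p.Monic) :
    ∃ (s u w : R[X]) (e : R) (N : ℕ), p ∣ s ^ N ∧ s ∣ p ∧ e ≠ 0 ∧
      s * u + s.derivative * w = C e := by
  classical
  let K := FractionRing R
  have hinj : Function.Injective (algebraMap R K) := IsFractionRing.injective R K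
  have : CharZero K := charZero_of_injective_algebraMap hinj
  set q := p.map (algebraMap R K)
  have hq : q ≠ 0 := (hp.map _).ne_zero
  set g := UniqueFactorizationMonoid.radical q
  have hgq : g ∣ q := UniqueFactorizationMonoid.radical_dvd_self
  have hg0 : g ≠ 0 := ne_zero_of_dvd_ne_zero hq hgq
  obtain ⟨N, hN⟩ := UniqueFactorizationMonoid.exists_dvd_radical_self_pow hq
  -- Gauss's lemma: a divisor of a monic polynomial over the fraction field descends, up to a
  -- constant, to the integrally closed base ring.
  obtain ⟨s, hs⟩ := IsIntegrallyClosed.eq_map_mul_C_of_dvd K hp hgq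
  have hu : IsUnit (C g.leadingCoeff : K[X]) :=
    isUnit_C.2 (isUnit_iff_ne_zero.2 (leadingCoeff_ne_zero.2 hg0))
  have hassoc : Associated (s.map (algebraMap R K)) g := by
    obtain ⟨c, hc⟩ := hu
    exact ⟨c, by rw [hc, hs]⟩
  have hsm : s.Monic := by
    refine monic_of_injective hinj ?_
    have h1 := congrArg leadingCoeff hs
    rw [leadingCoeff_mul, leadingCoeff_C] at h1
    exact mul_right_cancel₀ (leadingCoeff_ne_zero.2 hg0) (h1.trans (one_mul _).symm)
  have hdvd1 : s ∣ p := (map_dvd_map _ hinj hsm).1 (hassoc.dvd.trans hgq)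
  have hdvd2 : p ∣ s ^ N := by
    refine (map_dvd_map _ hinj hp).1 ?_
    rw [Polynomial.map_pow]
    exact hN.trans (pow_dvd_pow_of_dvd hassoc.symm.dvd N)
  have hsep : IsCoprime (s.map (algebraMap R K)) (s.map (algebraMap R K)).derivative := by
    change (s.map (algebraMap R K)).Separable
    rw [PerfectField.separable_iff_squarefree]
    exact UniqueFactorizationMonoid.squarefree_radical.squarefree_of_dvd hassoc.dvd
  by_cases h0 : s.natDegree = 0
  · refine ⟨s, 1, 0, 1, N, hdvd2, hdvd1, one_ne_zero, ?_⟩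
    rw [eq_one_of_monic_natDegree_zero hsm h0]
    simp
  -- The constant `e` is the resultant of `s` and its derivative, nonzero because `s` is separable
  -- over the fraction field. The Bézout identity needs positive degree, hence the separate case.
  · obtain ⟨u, w, -, -, huw⟩ := exists_mul_add_mul_eq_C_resultant s s.derivative le_rfl le_rfl
      (Or.inl h0)
    refine ⟨s, u, w, _, N, hdvd2, hdvd1, fun hres => ?_, huw⟩
    have h1 : (s.map (algebraMap R K)).resultant (s.map (algebraMap R K)).derivative = 0 := by
      rw [derivative_map, natDegree_map_eq_of_injective hinj, natDegree_map_eq_of_injective hinj,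
        resultant_map_map, hres, map_zero]
    exact (resultant_eq_zero_iff.1 h1).2 hsep

end SquarefreePart

/-! ### Homogenized evaluation, used to clear denominators in `z`. -/

section Homogenization

variable {𝒜 : Type*} [Ring 𝒜] [Algebra ℂ 𝒜]

/-- The homogenization `∑ qᵢ yⁱ t^(D - i)` of a polynomial `q` with respect to degree `D`. -/
noncomputable def homogenizedEval (D : ℕ) (q : ℂ[X]) (y t : 𝒜) : 𝒜 :=
  ∑ i ∈ Finset.range (D + 1), q.coeff i • (y ^ i * t ^ (D - i))

theorem homogenizedEval_mul {D : ℕ} {q : ℂ[X]} (hq : q.natDegree ≤ D) {h t : 𝒜}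
    (hc : Commute h t) : homogenizedEval D q (h * t) t = aeval h q * t ^ D := by
  rw [aeval_eq_sum_range' (Nat.lt_succ_iff.2 hq), Finset.sum_mul, homogenizedEval]
  refine Finset.sum_congr rfl fun i hi => ?_
  have hi' : i ≤ D := Nat.lt_succ_iff.1 (Finset.mem_range.1 hi)
  rw [hc.mul_pow, mul_assoc, ← pow_add, Nat.add_sub_cancel' hi', smul_mul_assoc]

theorem sub_dvd_homogenizedEval_sub (D : ℕ) (q : ℂ[X]) {y w t : 𝒜} (hyw : Commute y w) :
    y - w ∣ homogenizedEval D q y t - homogenizedEval D q w t := by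
  rw [homogenizedEval, homogenizedEval, ← Finset.sum_sub_distrib]
  refine Finset.dvd_sum fun i _ => ?_
  rw [← smul_sub, ← sub_mul]
  obtain ⟨c, hc⟩ := hyw.sub_dvd_pow_sub_pow i
  exact ⟨q.coeff i • (c * t ^ (D - i)), by rw [hc, mul_smul_comm, mul_assoc]⟩

theorem map_homogenizedEval {ℬ : Type*} [Ring ℬ] [Algebra ℂ ℬ] (φ : 𝒜 →ₐ[ℂ] ℬ) (D : ℕ) (q : ℂ[X])
    (y t : 𝒜) : φ (homogenizedEval D q y t) = homogenizedEval D q (φ y) (φ t) := by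
  simp [homogenizedEval]

end Homogenization

/-! ### The bivariate determinant and the annihilation identity. -/

section Bivariate

variable {r : ℕ} {A B : Matrix (Fin r) (Fin r) ℂ}

/-- The polynomial `symbolPoly A B x` with `x` replaced by an indeterminate: the inner variable is
`x`, the outer variable is `z`. -/
noncomputable def bivariateSymbol (A B : Matrix (Fin r) (Fin r) ℂ) : ℂ[X][X] :=
  Matrix.det ((X ^ 2 : ℂ[X][X]) • (A.conjTranspose.map C).map C
    + (X : ℂ[X][X]) • (B.map C - (X : ℂ[X]) • (1 : Matrix (Fin r) (Fin r) ℂ[X])).map C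
    + (A.map C).map C)

theorem bivariateSymbol_map (x : ℂ) :
    (bivariateSymbol A B).map (evalRingHom x) = symbolPoly A B x := by
  rw [bivariateSymbol, symbolPoly, ← coe_mapRingHom, RingHom.map_det]
  congr 1
  ext i j : 1
  by_cases hij : i = j <;> simp [hij]

theorem bivariateSymbol_eval {z : ℂ} (hz : z ≠ 0) :
    (bivariateSymbol A B).eval (C z)
      = C ((-z) ^ r) * (z • A.conjTranspose + B + z⁻¹ • A).charpoly := by
  have h1 : (bivariateSymbol A B).eval (C z)
      = ((C (-z)) • (z • A.conjTranspose + B + z⁻¹ • A).charmatrix).det := by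
    rw [bivariateSymbol, ← coe_evalRingHom, RingHom.map_det]
    congr 1
    ext i j : 1
    have h2 : (C z : ℂ[X]) * C z⁻¹ = 1 := by rw [← C_mul, mul_inv_cancel₀ hz, C_1]
    by_cases hij : i = j
    · subst hij
      simp
      linear_combination (-C (A i i)) * h2
    · simp [hij]
      linear_combination (-C (A i j)) * h2
  rw [h1, Matrix.det_smul, Fintype.card_fin, ← C_pow, Matrix.charpoly]

theorem bivariateSymbol_natDegree_le_and_coeff :
    (bivariateSymbol A B).natDegree ≤ r * 2 ∧
      (bivariateSymbol A B).coeff (r * 2) = C A.conjTranspose.det := by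
  have h := coeff_det_of_natDegree_le ((X ^ 2 : ℂ[X][X]) • (A.conjTranspose.map C).map C
    + (X : ℂ[X][X]) • (B.map C - (X : ℂ[X]) • (1 : Matrix (Fin r) (Fin r) ℂ[X])).map C
    + (A.map C).map C) 2 fun i j => by
      simp only [Matrix.add_apply, Matrix.smul_apply, Matrix.map_apply, smul_eq_mul]
      compute_degree
  rw [Fintype.card_fin] at h
  refine ⟨h.1, h.2.trans ?_⟩
  rw [RingHom.map_det]
  congr 1
  ext i j : 1
  simp only [Matrix.add_apply, Matrix.smul_apply, Matrix.map_apply, smul_eq_mul, coeff_add,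
    RingHom.mapMatrix_apply]
  rw [coeff_C, show (2 : ℕ) = 1 + 1 from rfl, coeff_X_mul, coeff_C, coeff_X_pow_mul', coeff_C]
  simp

theorem bivariateSymbol_monic (hA : IsUnit A) :
    (C (C (A.conjTranspose.det)⁻¹) * bivariateSymbol A B).Monic := by
  have hdet : A.conjTranspose.det ≠ 0 := by
    rw [Matrix.det_conjTranspose, Ne, star_eq_zero]
    exact ((Matrix.isUnit_iff_isUnit_det _).1 hA).ne_zero
  obtain ⟨h1, h2⟩ := bivariateSymbol_natDegree_le_and_coeff (A := A) (B := B)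
  refine monic_of_natDegree_le_of_coeff_eq_one (r * 2) ((natDegree_C_mul_le _ _).trans h1) ?_
  rw [coeff_C_mul, h2, ← C_mul, inv_mul_cancel₀ hdet, C_1]

theorem symbolPoly_natDegree (hA : IsUnit A) (x : ℂ) : (symbolPoly A B x).natDegree = 2 * r := by
  obtain ⟨h1, h2⟩ := bivariateSymbol_natDegree_le_and_coeff (A := A) (B := B)
  rw [← bivariateSymbol_map, mul_comm]
  refine natDegree_eq_of_le_of_coeff_ne_zero (natDegree_map_le.trans h1) ?_
  rw [coeff_map, h2, coe_evalRingHom, eval_C, Matrix.det_conjTranspose, Ne, star_eq_zero]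
  exact ((Matrix.isUnit_iff_isUnit_det _).1 hA).ne_zero

theorem aeval_mulVec_of_eigen {H : Matrix (Fin r) (Fin r) ℂ} {v : Fin r → ℂ} {μ : ℂ}
    (h : H.mulVec v = μ • v) (q : ℂ[X]) : (aeval H q).mulVec v = q.eval μ • v := by
  induction q using Polynomial.induction_on' with
  | add p q hp hq => rw [map_add, Matrix.add_mulVec, hp, hq, eval_add, add_smul]
  | monomial n c =>
    rw [aeval_monomial, eval_monomial, ← Algebra.smul_def, Matrix.smul_mulVec, mul_smul]
    congr 1
    induction n with
    | zero => simp
    | succ n ih => rw [pow_succ, ← Matrix.mulVec_mulVec, h, Matrix.mulVec_smul, ih, smul_smul,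
        pow_succ']

/-- On an eigenvector `q ^ N` acts as the scalar `q(μ) ^ N`, which is zero by Cayley–Hamilton, so
`q(μ) = 0`. A Hermitian matrix has a basis of eigenvectors. -/
theorem aeval_eq_zero_of_charpoly_dvd_pow {H : Matrix (Fin r) (Fin r) ℂ} (hH : H.IsHermitian)
    {q : ℂ[X]} {N : ℕ} (h : H.charpoly ∣ q ^ N) : aeval H q = 0 := by
  have h0 : aeval H (q ^ N) = 0 := by
    obtain ⟨c, hc⟩ := h
    rw [hc, map_mul, Matrix.aeval_self_charpoly, zero_mul]
  have h1 : ∀ j, (aeval H q).mulVec (hH.eigenvectorBasis j).ofLp = 0 := by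
    intro j
    have he : H.mulVec (hH.eigenvectorBasis j).ofLp
        = (hH.eigenvalues j : ℂ) • (hH.eigenvectorBasis j).ofLp := hH.mulVec_eigenvectorBasis j
    have h2 := aeval_mulVec_of_eigen he (q ^ N)
    rw [h0, Matrix.zero_mulVec, eq_comm, smul_eq_zero, eval_pow] at h2
    have hne : (hH.eigenvectorBasis j).ofLp ≠ 0 := fun hz =>
      hH.eigenvectorBasis.orthonormal.ne_zero j (by ext i; exact congrFun hz i)
    rw [aeval_mulVec_of_eigen he, IsNilpotent.eq_zero ⟨N, h2.resolve_right hne⟩, zero_smul]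
  have h3 : Matrix.toEuclideanLin (aeval H q) = 0 := by
    refine hH.eigenvectorBasis.toBasis.ext fun j => ?_
    rw [OrthonormalBasis.coe_toBasis, LinearMap.zero_apply]
    ext i
    exact congrFun (h1 j) i
  exact (LinearEquiv.map_eq_zero_iff _).1 h3

theorem isHermitian_of_norm_eq_one (hB : B.IsHermitian) {z : ℂ} (hz : ‖z‖ = 1) :
    (z • A.conjTranspose + B + z⁻¹ • A).IsHermitian := by
  have h1 : z⁻¹ = star z := by
    rw [Complex.inv_def, Complex.normSq_eq_norm_sq, hz]
    simp
  rw [h1, Matrix.IsHermitian, Matrix.conjTranspose_add, Matrix.conjTranspose_add,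
    Matrix.conjTranspose_smul, Matrix.conjTranspose_smul, Matrix.conjTranspose_conjTranspose,
    star_star, hB.eq]
  abel

/-- The matrix of the symbol, cleared of denominators, without the spectral parameter. -/
noncomputable def symbolNumerator (A B : Matrix (Fin r) (Fin r) ℂ) : Matrix (Fin r) (Fin r) ℂ[X] :=
  (X ^ 2 : ℂ[X]) • A.conjTranspose.map C + (X : ℂ[X]) • B.map C + A.map C

theorem mapMatrix_aeval_symbolNumerator {z : ℂ} (hz : z ≠ 0) :
    (aeval z : ℂ[X] →ₐ[ℂ] ℂ).mapMatrix (symbolNumerator A B)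
      = (z • A.conjTranspose + B + z⁻¹ • A) * (z • (1 : Matrix (Fin r) (Fin r) ℂ)) := by
  ext i j
  simp [symbolNumerator]
  field_simp

/-- A bivariate polynomial that annihilates the Hermitian symbol on the unit circle is, after
multiplication by a power of `z` and specialization of `x`, a left multiple of the symbol. -/
theorem exists_symbol_mul_eq (s : ℂ[X][X])
    (hs : ∀ z : ℂ, ‖z‖ = 1 → aeval (z • A.conjTranspose + B + z⁻¹ • A) (s.eval (C z)) = 0) :
    ∃ D : ℕ, ∀ x : ℂ, ∃ G : Matrix (Fin r) (Fin r) ℂ[X],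
      ((X ^ 2 : ℂ[X]) • A.conjTranspose.map C
        + (X : ℂ[X]) • (B - x • (1 : Matrix (Fin r) (Fin r) ℂ)).map C + A.map C) * G
      = (X ^ D * s.map (evalRingHom x)) • (1 : Matrix (Fin r) (Fin r) ℂ[X]) := by
  set D := s.support.sup fun k => (s.coeff k).natDegree
  have hD : ∀ k, (s.coeff k).natDegree ≤ D := by
    intro k
    by_cases hk : k ∈ s.support
    · exact Finset.le_sup (f := fun k => (s.coeff k).natDegree) hk
    · rw [notMem_support_iff.1 hk, natDegree_zero]
      exact Nat.zero_le _
  set T : Matrix (Fin r) (Fin r) ℂ[X] := (X : ℂ[X]) • 1 with hT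
  set S := symbolNumerator A B with hS
  -- With `S = z H(z)` and `T = z I`, homogenization gives `Z S = z^D s(z, H(z))`, now polynomial in
  -- `z`.
  let Z : Matrix (Fin r) (Fin r) ℂ[X] → Matrix (Fin r) (Fin r) ℂ[X] := fun y =>
    ∑ k ∈ Finset.range (s.natDegree + 1), (X ^ k : ℂ[X]) • homogenizedEval D (s.coeff k) y T
  have hTc : ∀ y : Matrix (Fin r) (Fin r) ℂ[X], Commute y T := fun y => by
    rw [hT, Commute, SemiconjBy]
    simp
  have hZ0 : Z S = 0 := by
    have hev : ∀ z : ℂ, ‖z‖ = 1 → (aeval z : ℂ[X] →ₐ[ℂ] ℂ).mapMatrix (Z S) = 0 := by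
      intro z hz
      have hz0 : z ≠ 0 := fun h => by simp [h] at hz
      have hTz : (aeval z : ℂ[X] →ₐ[ℂ] ℂ).mapMatrix T = z • (1 : Matrix (Fin r) (Fin r) ℂ) := by
        ext i j
        by_cases hij : i = j <;> simp [hT, hij]
      have hcz : Commute (z • A.conjTranspose + B + z⁻¹ • A)
          (z • (1 : Matrix (Fin r) (Fin r) ℂ)) := by
        rw [Commute, SemiconjBy]
        simp
      have hsm : ∀ (q : ℂ[X]) (Q : Matrix (Fin r) (Fin r) ℂ[X]),
          (aeval z : ℂ[X] →ₐ[ℂ] ℂ).mapMatrix (q • Q)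
            = q.eval z • (aeval z : ℂ[X] →ₐ[ℂ] ℂ).mapMatrix Q := fun q Q => by
        ext i j
        simp
      have hsz := hs z hz
      rw [eval_eq_sum_range, map_sum] at hsz
      simp only [Z, map_sum, hsm, map_homogenizedEval, hS, hTz,
        mapMatrix_aeval_symbolNumerator hz0, homogenizedEval_mul (hD _) hcz]
      rw [← zero_mul ((z • (1 : Matrix (Fin r) (Fin r) ℂ)) ^ D), ← hsz, Finset.sum_mul]
      refine Finset.sum_congr rfl fun k _ => ?_
      rw [← C_pow, map_mul, aeval_C, ← Algebra.commutes, ← Algebra.smul_def, smul_mul_assoc,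
        eval_pow, eval_X]
    ext1 i j
    -- Each entry is a polynomial vanishing on the whole unit circle, an infinite set, so the
    -- identity holds for every `z`.
    refine eq_zero_of_infinite_isRoot _ (Set.Infinite.mono (s := Metric.sphere (0 : ℂ) 1) ?_ ?_)
    · intro z hz
      have := congrFun (congrFun (hev z (by simpa using hz)) i) j
      simpa using this
    · refine (isPreconnected_sphere (by simp [Complex.rank_real_complex]) (0 : ℂ)
        1).infinite_of_nontrivial ⟨1, by simp, -1, by simp, by norm_num⟩
  refine ⟨D, fun x => ?_⟩
  set y : Matrix (Fin r) (Fin r) ℂ[X] := algebraMap ℂ _ x * T with hy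
  have hF : (X ^ 2 : ℂ[X]) • A.conjTranspose.map C
        + (X : ℂ[X]) • (B - x • (1 : Matrix (Fin r) (Fin r) ℂ)).map C + A.map C = S - y := by
    ext1 i j
    rw [hS, hy, hT, symbolNumerator]
    by_cases hij : i = j
    · simp [hij, Matrix.algebraMap_eq_diagonal]
      ring
    · simp [hij, Matrix.algebraMap_eq_diagonal]
  have hZy : Z y = (X ^ D * s.map (evalRingHom x)) • (1 : Matrix (Fin r) (Fin r) ℂ[X]) := by
    have hk : ∀ k, (X ^ k : ℂ[X]) • homogenizedEval D (s.coeff k) y T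
        = (X ^ D * (C ((s.coeff k).eval x) * X ^ k)) • (1 : Matrix (Fin r) (Fin r) ℂ[X]) := by
      intro k
      rw [hy, homogenizedEval_mul (hD k) (Algebra.commute_algebraMap_left x T),
        aeval_algebraMap_apply, ← Algebra.smul_def, hT, _root_.smul_pow, one_pow, coe_aeval_eq_eval,
        ← algebraMap_smul ℂ[X] ((s.coeff k).eval x), smul_smul, smul_smul]
      congr 1
      rw [algebraMap_eq]
      ring
    simp only [Z, hk]
    rw [← Finset.sum_smul, ← Finset.mul_sum]
    congr 2
    conv_rhs => rw [s.as_sum_range_C_mul_X_pow, Polynomial.map_sum]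
    simp
  -- The scalar matrix `y = x T` commutes with `S`, so the factor theorem applies. Here `S - y` is
  -- the cleared symbol, `Z S = 0` and `Z y = z^D s(z, x) I`.
  have hdvd : S - y ∣ Z S - Z y := by
    simp only [Z]
    rw [← Finset.sum_sub_distrib]
    refine Finset.dvd_sum fun k _ => ?_
    obtain ⟨c, hc⟩ := sub_dvd_homogenizedEval_sub D (s.coeff k) (t := T)
      (show Commute S y from (Algebra.commute_algebraMap_right x S).mul_right (hTc S))
    exact ⟨(X ^ k : ℂ[X]) • c, by
      rw [← smul_sub, mul_smul_comm]
      exact congrArg _ hc⟩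
  obtain ⟨c, hc⟩ := hdvd
  refine ⟨-c, ?_⟩
  rw [hF, mul_neg, ← hc, hZ0, zero_sub, neg_neg, hZy]

end Bivariate

/-! ### Finiteness of the exceptional set. -/

section Exceptional

variable {r : ℕ} {A B : Matrix (Fin r) (Fin r) ℂ}

theorem geomMult_eq_finrank_ker {z : ℂ} (hz : z ≠ 0) (x : ℂ) :
    geomMult A B z x = Module.finrank ℂ (LinearMap.ker
      (((X ^ 2 : ℂ[X]) • A.conjTranspose.map C
        + (X : ℂ[X]) • (B - x • (1 : Matrix (Fin r) (Fin r) ℂ)).map C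
        + A.map C).map (eval z)).mulVecLin) := by
  have h1 : ((X ^ 2 : ℂ[X]) • A.conjTranspose.map C
        + (X : ℂ[X]) • (B - x • (1 : Matrix (Fin r) (Fin r) ℂ)).map C
        + A.map C).map (eval z) = z • symbolMatrix A B z x := by
    rw [smul_symbolMatrix hz]
    ext i j
    simp
    exact mul_comm _ _
  have h2 : LinearMap.ker (z • symbolMatrix A B z x).mulVecLin
      = LinearMap.ker (symbolMatrix A B z x).mulVecLin := by
    ext v
    simp [hz]
  rw [h1, h2, geomMult]

/-- For all but finitely many `x`, geometric and algebraic multiplicities coincide. -/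
theorem exists_ne_zero_forall_geomMult_eq_algMult (hA : IsUnit A) (hB : B.IsHermitian) :
    ∃ e : ℂ[X], e ≠ 0 ∧ ∀ x, e.eval x ≠ 0 → ∀ z, (symbolPoly A B x).eval z = 0 →
      geomMult A B z x = algMult A B z x := by
  obtain ⟨s, u, w, e, N, h1, -, he, huw⟩ :=
    exists_monic_separable_part (bivariateSymbol_monic (B := B) hA)
  have h2 : bivariateSymbol A B ∣ s ^ N := (dvd_mul_left _ _).trans h1
  obtain ⟨D, hD⟩ := exists_symbol_mul_eq (A := A) (B := B) s fun z hz => by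
    have hz0 : z ≠ 0 := fun h => by simp [h] at hz
    refine aeval_eq_zero_of_charpoly_dvd_pow (isHermitian_of_norm_eq_one hB hz) (N := N) ?_
    have h3 := eval_dvd (x := (C z : ℂ[X])) h2
    rw [bivariateSymbol_eval hz0, eval_pow] at h3
    exact (dvd_mul_left _ _).trans h3
  refine ⟨e, he, fun x hx z hz => ?_⟩
  have hz0 : z ≠ 0 := fun h => by
    rw [h, symbolPoly_eval_zero] at hz
    exact ((Matrix.isUnit_iff_isUnit_det _).1 hA).ne_zero hz
  obtain ⟨G, hG⟩ := hD x
  set t := s.map (evalRingHom x) with ht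
  have htz : t.eval z = 0 := by
    have h3 := map_dvd (mapRingHom (evalRingHom x)) h2
    rw [map_pow, coe_mapRingHom, bivariateSymbol_map, ← ht] at h3
    have h4 := eval_dvd (x := z) h3
    rw [hz, zero_dvd_iff, eval_pow] at h4
    exact IsNilpotent.eq_zero ⟨N, h4⟩
  -- At a common zero of `t` and its derivative the Bézout identity would give `e(x) = 0`.
  have htd : t.derivative.eval z ≠ 0 := fun h => hx (by
    have h3 := congrArg (fun p => (p.map (evalRingHom x)).eval z) huw
    simp only [Polynomial.map_add, Polynomial.map_mul, ← derivative_map, ← ht, eval_add, eval_mul,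
      htz, h, zero_mul, add_zero, map_C, eval_C, coe_evalRingHom] at h3
    exact h3.symm)
  rw [geomMult_eq_finrank_ker hz0, algMult, symbolPoly]
  -- Since `z ≠ 0`, the factor `X ^ D` leaves the simple root of `t` simple.
  refine finrank_ker_eq_rootMultiplicity_det hG (by simp [htz]) ?_
  simp [htz, htd, hz0]

theorem Multiset.exists_map_univ_eq {α : Type*} (m : Multiset α) {n : ℕ} (h : m.card = n) :
    ∃ y : Fin n → α, Multiset.map y Finset.univ.val = m := by
  subst h
  rcases m with ⟨l⟩
  exact ⟨l.get, (Fin.univ_val_map l.get).trans (congrArg _ (List.ofFn_get l))⟩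

theorem exists_isRootLabelling (hA : IsUnit A) (x : ℂ) : ∃ z, IsRootLabelling A B x z := by
  obtain ⟨y, hy⟩ := Multiset.exists_map_univ_eq (symbolPoly A B x).roots (n := 2 * r) (by
    rw [← (IsAlgClosed.splits (symbolPoly A B x)).natDegree_eq_card_roots,
      symbolPoly_natDegree hA])
  refine ⟨y ∘ Tuple.sort fun k => ‖y k‖, ?_, Tuple.monotone_sort fun k => ‖y k‖⟩
  rw [← hy, ← Multiset.map_map]
  congr 1
  exact congrArg Finset.val (Finset.map_univ_equiv (Tuple.sort fun k => ‖y k‖))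

/-- A finite-dimensional space of vectors has a spanning family of unit vectors. -/
theorem exists_unit_spanning (N : Submodule ℂ (Fin r → ℂ)) {ι : Type*} [Fintype ι]
    (hι : Fintype.card ι = Module.finrank ℂ N) :
    ∃ u : ι → Fin r → ℂ, (∀ i, ‖WithLp.toLp 2 (u i)‖ = 1) ∧ (∀ i, u i ∈ N) ∧
      Submodule.span ℂ (Set.range u) = N := by
  let bs : Module.Basis ι ℂ N := (Module.finBasis ℂ N).reindex (Fintype.equivFinOfCardEq hι).symm
  have hn : ∀ i, ‖WithLp.toLp 2 (bs i : Fin r → ℂ)‖ ≠ 0 := fun i h => bs.ne_zero i (by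
    ext j
    have := congrArg (fun v : EuclideanSpace ℂ (Fin r) => v j) (norm_eq_zero.1 h)
    simpa using this)
  have hunit : ∀ i, IsUnit ((‖WithLp.toLp 2 (bs i : Fin r → ℂ)‖ : ℂ)⁻¹) := fun i =>
    isUnit_iff_ne_zero.2 (inv_ne_zero (by exact_mod_cast hn i))
  let b' := bs.isUnitSMul hunit
  refine ⟨fun i => b' i, fun i => ?_, fun i => (b' i).2, ?_⟩
  · simp only [b', Module.Basis.isUnitSMul_apply, Submodule.coe_smul, WithLp.toLp_smul]
    rw [norm_smul, norm_inv, Complex.norm_real, norm_norm, inv_mul_cancel₀ (hn i)]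
  · have h := congrArg (Submodule.map N.subtype) b'.span_eq
    rw [Submodule.map_span, ← Set.range_comp, Submodule.map_top, Submodule.range_subtype] at h
    exact h

theorem exists_isNullVectorChoice {x : ℂ} {z : Fin (2 * r) → ℂ} (hz : IsRootLabelling A B x z)
    (h : ∀ k, geomMult A B (z k) x = algMult A B (z k) x) : ∃ v, IsNullVectorChoice A B x z v := by
  have hex : ∀ μ : ℂ, ∃ u : {l // z l = μ} → Fin r → ℂ, (∃ k, z k = μ) →
      (∀ i, ‖WithLp.toLp 2 (u i)‖ = 1) ∧
      (∀ i, u i ∈ LinearMap.ker (symbolMatrix A B μ x).mulVecLin) ∧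
      Submodule.span ℂ (Set.range u) = LinearMap.ker (symbolMatrix A B μ x).mulVecLin := by
    intro μ
    by_cases hμ : ∃ k, z k = μ
    · obtain ⟨k, rfl⟩ := hμ
      obtain ⟨u, hu⟩ := exists_unit_spanning (LinearMap.ker (symbolMatrix A B (z k) x).mulVecLin)
        (ι := {l // z l = z k}) ((card_eq_algMult hz _).trans (h k).symm)
      exact ⟨u, fun _ => hu⟩
    · exact ⟨0, fun h => absurd h hμ⟩
  choose u hu using hex
  have hu' := fun k => hu (z k) ⟨k, rfl⟩
  refine ⟨fun k => u (z k) ⟨k, rfl⟩, fun k => (hu' k).1 _, fun k => (hu' k).2.1 _,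
    fun k => ⟨?_, h k⟩⟩
  have himg : (fun k => u (z k) ⟨k, rfl⟩) '' {l | z l = z k} = Set.range (u (z k)) := by
    rw [Set.image_eq_range]
    congr 1
    ext1 ⟨l, hl⟩
    have : ∀ (μ : ℂ) (hμ : z l = μ), u (z l) ⟨l, rfl⟩ = u μ ⟨l, hμ⟩ := by
      rintro _ rfl
      rfl
    exact this _ hl
  rw [himg, (hu' k).2.2, geomMult]

theorem exceptionalSet_finite (hA : IsUnit A) (hB : B.IsHermitian) :
    (exceptionalSet A B).Finite := by
  obtain ⟨e, he, h⟩ := exists_ne_zero_forall_geomMult_eq_algMult hA hB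
  refine (e.rootSet_finite ℂ).subset fun x hx => ?_
  by_contra hxe
  have hx0 : e.eval x ≠ 0 := fun h0 => hxe (by
    rw [mem_rootSet]
    exact ⟨he, by simpa using h0⟩)
  obtain ⟨z, hz⟩ := exists_isRootLabelling (B := B) hA x
  obtain ⟨v, hv⟩ := exists_isNullVectorChoice hz fun k => h x hx0 _ (by
    have h1 : z k ∈ (symbolPoly A B x).roots := by
      rw [← hz.1]
      exact Multiset.mem_map_of_mem _ (Finset.mem_univ k)
    exact isRoot_of_mem_roots h1)
  exact hx ⟨z, v, hz, hv⟩

end Exceptional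

/-! ### The main theorem. -/

theorem theorem2p3 (r : ℕ) (hr : 1 ≤ r)
    (A B : Matrix (Fin r) (Fin r) ℂ) (hA : IsUnit A) (hB : B.IsHermitian)
    (a b : ℕ → Matrix (Fin r) (Fin r) ℂ)
    (ha : ∀ n, 1 ≤ n → IsUnit (a n)) (hb : ∀ n, (b n).IsHermitian)
    (haA : Tendsto a atTop (𝓝 A)) (hbB : Tendsto b atTop (𝓝 B))
    (M : ℝ) (hM : 0 < M)
    (hzeros : ∀ (n : ℕ) (x : ℂ), (matrixOP a b n x).det = 0 → x ∈ realSegment M) :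
    (exceptionalSet A B).Finite ∧
    ∃ R : ℂ → Matrix (Fin r) (Fin r) ℂ,
      (∀ x, x ∉ realSegment M ∪ exceptionalSet A B →
        Tendsto (fun n => matrixOP a b n x * (matrixOP a b (n + 1) x)⁻¹) atTop (𝓝 (R x)) ∧
        MatrixDiagonalizable (R x) ∧
        ∀ z v, IsRootLabelling A B x z → IsNullVectorChoice A B x z v →
          LinearIndependent ℂ (fun k : Fin r => v (firstHalf k)) ∧
          ∀ k : Fin r, (R x).mulVec (v (firstHalf k)) = z (firstHalf k) • v (firstHalf k)) ∧
      ∀ K : Set ℂ, IsCompact K → K ⊆ (realSegment M ∪ exceptionalSet A B)ᶜ →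
        TendstoUniformlyOn (fun (n : ℕ) (x : ℂ) => matrixOP a b n x * (matrixOP a b (n + 1) x)⁻¹)
          R atTop K ∧
        ∀ (z : ℂ → Fin (2 * r) → ℂ) (v : ℂ → Fin (2 * r) → Fin r → ℂ),
          (∀ x ∈ K, IsRootLabelling A B x (z x) ∧ IsNullVectorChoice A B x (z x) (v x)) →
          TendstoUniformlyOn
            (fun (n : ℕ) (p : Fin r × ℂ) =>
              (matrixOP a b n p.2 * (matrixOP a b (n + 1) p.2)⁻¹).mulVec (v p.2 (firstHalf p.1)))
            (fun p => z p.2 (firstHalf p.1) • v p.2 (firstHalf p.1))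
            atTop (Set.univ ×ˢ K) := by
  have hlim : ∀ x, x ∉ realSegment M ∪ exceptionalSet A B → x ∉ realSegment M :=
    fun x hx h => hx (Or.inl h)
  refine ⟨exceptionalSet_finite hA hB, fun x => weylLimit a b x * A, fun x hx => ⟨?_, ?_, ?_⟩,
    fun K hK hKs => ⟨?_, fun z v hzv => ?_⟩⟩
  · exact tendsto_matrixOP_ratio ha hb hA haA hbB hzeros (hlim x hx)
  · have hxS : x ∉ exceptionalSet A B := fun h => hx (Or.inr h)
    obtain ⟨z, v, hz, hv⟩ := not_not.1 hxS
    have hR := weylLimit_mulVec ha hb hA haA hbB hzeros (hlim x hx) hz hv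
    exact matrixDiagonalizable_of_linearIndependent _ _ (linearIndependent_firstHalf hz hv hR) hR
  · intro z v hz hv
    have hR := weylLimit_mulVec ha hb hA haA hbB hzeros (hlim x hx) hz hv
    exact ⟨linearIndependent_firstHalf hz hv hR, hR⟩
  · exact tendstoUniformlyOn_matrixOP_ratio ha hb hA haA hbB hzeros hK
      fun x hx => hlim x (hKs hx)
  · have hU := tendstoUniformlyOn_matrixOP_ratio ha hb hA haA hbB hzeros hK
      fun x hx => hlim x (hKs hx)
    refine (tendstoUniformlyOn_mulVec (ι := Fin r) hU (fun p => v p.2 (firstHalf p.1))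
      fun k x hx => ((hzv x hx).2.1 _).le).congr_right ?_
    rintro ⟨k, x⟩ ⟨-, hx⟩
    exact weylLimit_mulVec ha hb hA haA hbB hzeros (hlim x (hKs hx)) (hzv x hx).1 (hzv x hx).2 k
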